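/- Let $\mathcal A$ be a unital pro-$C^*$-algebra, i.e. a complete Hausdorff complex topological $*$-algebra with unit $1_{\mathcal A}$ in which a net $(a_\alpha)$ converges to $0$ if and only if $p(a_\alpha)\to 0$ for every $p\in S(\mathcal A)$, where $S(\mathcal A)$ is the set of continuous seminorms $p$ on $\mathcal A$ with $p(ab)\le p(a)p(b)$ and $p(a^*a)=p(a)^2$. Let $\mathcal X$ be a Hilbert $\mathcal A$-module, i.e. a complex vector space and compatible left $\mathcal A$-module with an $\mathcal A$-valued inner product $\langle\cdot,\cdot\rangle$ that is $\mathbb C$- and $\mathcal A$-linear in its first variable, satisfies $\langle\xi,\eta\rangle^*=\langle\eta,\xi\rangle$, $\langle\xi,\xi\rangle\ge 0$, and $\langle\xi,\xi\rangle=0$ only for $\xi=0$, and such that $\mathcal X$ is complete in the topology of the seminorms $\bar p(\xi)=\sqrt{p(\langle\xi,\xi\rangle)}$, $p\in S(\mathcal A)$. Let $Hom^*_{\mathcal A}(\mathcal X)$ be the set of $\mathcal A$-module maps $T:\mathcal X\to\mathcal X$ that have an adjoint $T^*$ (so $\langle T\xi,\eta\rangle=\langle\xi,T^*\eta\rangle$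 for all $\xi,\eta$) and are bounded (for each $p\in S(\mathcal A)$ there is $M_p>0$ with $\bar p(T\xi)\le M_p\,\bar p(\xi)$ for all $\xi$). Such an operator $Q$ is positive if $\langle Q\xi,\xi\rangle\ge0$ for all $\xi\in\mathcal X$. Let $I$ be a countable set. A family $\{T_i\}_{i\in I}\subset Hom^*_{\mathcal A}(\mathcal X)$ is a $*$-operator frame with bounds $A,B\in\mathcal A$ if $0$ lies in the spectrum of neither $A$ nor $B$ and, for every $\xi\in\mathcal X$, the series $\sum_{i\in I}\langle T_i\xi,T_i\xi\rangle$ converges in $\mathcal A$ and $$A\langle\xi,\xi\rangle A^*\le\sum_{i\in I}\langle T_i\xi,T_i\xi\rangle\le B\langle\xi,\xi\rangle B^*.$$ It is a Parseval $*$-operator frame if this holds with $A=B=1_{\mathcal A}$. Corollary 3.11. Let $\{T_i\}_{i\in I}\subset Hom^*_{\mathcal A}(\mathcal X)$ be a $*$-operator frame (with some bounds $A,B$). Then there is a unique $S\in Hom^*_{\mathcal A}(\mathcal X)$ with $S\xi=\sum_{i\in I}T_i^*T_i\xi$ (convergence in $\mathcal X$) for all $\xi\in\mathcal X$, the $*$-frame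 operator of $\{T_i\}$; $S$ is invertible in $Hom^*_{\mathcal A}(\mathcal X)$, and there is a unique positive $S^{-1/2}\in Hom^*_{\mathcal A}(\mathcal X)$ whose square is $S^{-1}$; and $\{T_iS^{-1/2}\}_{i\in I}$ is a Parseval $*$-operator frame for $\mathcal X$. -/

import Mathlib

open Filter Topology

/-- A continuous C⋆-seminorm on a complex topological ⋆-algebra `A`; the type of all of them is the
set usually written `S(A)`. -/
structure ContCStarSeminorm (A : Type*) [Ring A] [StarRing A] [Algebra ℂ A]
    [TopologicalSpace A] extends Seminorm ℂ A where
  mul_le' : ∀ a b : A, toFun (a * b) ≤ toFun a * toFun b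
  star_mul_self' : ∀ a : A, toFun (star a * a) = toFun a ^ 2
  continuous' : Continuous toFun

instance (A : Type*) [Ring A] [StarRing A] [Algebra ℂ A] [TopologicalSpace A] :
    CoeFun (ContCStarSeminorm A) (fun _ => A → ℝ) :=
  ⟨fun p => p.toFun⟩

/-- A unital pro-C⋆-algebra: a complete Hausdorff complex topological ⋆-algebra in which a net `a`
tends to `0` if and only if `p a` tends to `0` for every continuous C⋆-seminorm `p`.
(Nets are replaced by filters.) -/
class IsProCStarAlgebra (A : Type*) [Ring A] [StarRing A] [Algebra ℂ A] [UniformSpace A] : Prop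
    extends StarModule ℂ A, IsUniformAddGroup A, IsTopologicalRing A, ContinuousSMul ℂ A,
      ContinuousStar A, CompleteSpace A, T2Space A where
  tendsto_zero_iff : ∀ l : Filter A,
    Tendsto id l (𝓝 0) ↔ ∀ p : ContCStarSeminorm A, Tendsto (fun a => p a) l (𝓝 0)

/-- A pre-Hilbert module over `A`: a complex vector space that is a compatible left `A`-module, with
an `A`-valued inner product which is `ℂ`- and `A`-linear in the first variable. -/
class PreHilbertProCStarModule (A X : Type*) [Ring A] [StarRing A] [Algebra ℂ A] [PartialOrder A]
    [AddCommGroup X] [Module ℂ X] [Module A X] [IsScalarTower ℂ A X] where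
  /-- The `A`-valued inner product. -/
  ip : X → X → A
  ip_add_left : ∀ ξ ζ η : X, ip (ξ + ζ) η = ip ξ η + ip ζ η
  ip_smul_left : ∀ (a : A) (ξ η : X), ip (a • ξ) η = a * ip ξ η
  ip_csmul_left : ∀ (c : ℂ) (ξ η : X), ip (c • ξ) η = c • ip ξ η
  star_ip : ∀ ξ η : X, star (ip ξ η) = ip η ξ
  ip_self_nonneg : ∀ ξ : X, 0 ≤ ip ξ ξ
  ip_self_eq_zero : ∀ ξ : X, ip ξ ξ = 0 ↔ ξ = 0

section HilbertModules

variable (A : Type*) [Ring A] [StarRing A] [Algebra ℂ A] [PartialOrder A]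

/-- The `A`-valued inner product, with `A` explicit. -/
def moduleInner {X : Type*} [AddCommGroup X] [Module ℂ X] [Module A X] [IsScalarTower ℂ A X]
    [PreHilbertProCStarModule A X] (ξ η : X) : A :=
  PreHilbertProCStarModule.ip ξ η

variable {A}

/-- The seminorm `ξ ↦ √(p ⟨ξ, ξ⟩)` on `X` attached to a continuous C⋆-seminorm `p` on `A`. -/
noncomputable def moduleSeminorm [TopologicalSpace A] (p : ContCStarSeminorm A) {X : Type*}
    [AddCommGroup X] [Module ℂ X] [Module A X] [IsScalarTower ℂ A X]
    [PreHilbertProCStarModule A X] (ξ : X) : ℝ :=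
  √(p (moduleInner A ξ ξ))

/-- `X` is a Hilbert `A`-module: it is complete for the topology determined by the seminorms
`moduleSeminorm p`, `p ∈ S(A)`. (The uniform structure of `X` is the one of an additive topological
group, hence is determined by the neighbourhoods of `0`.) -/
class IsHilbertProCStarModule (A X : Type*) [Ring A] [StarRing A] [Algebra ℂ A] [PartialOrder A]
    [TopologicalSpace A] [AddCommGroup X] [Module ℂ X] [Module A X] [IsScalarTower ℂ A X]
    [PreHilbertProCStarModule A X] [UniformSpace X] : Prop where
  isUniformAddGroup : IsUniformAddGroup X
  nhds_zero : 𝓝 (0 : X) =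
    ⨅ p : ContCStarSeminorm A, comap (fun ξ : X => moduleSeminorm p ξ) (𝓝 0)
  completeSpace : CompleteSpace X

/-- `Hom⋆_A(X, Y)`: bounded `A`-module maps `T : X → Y` that have an adjoint `T⋆ : Y → X`. As the
inner product is definite, the adjoint is determined by `T`, see `AdjointableOperator.ext`. -/
structure AdjointableOperator (A X Y : Type*) [Ring A] [StarRing A] [Algebra ℂ A] [PartialOrder A]
    [TopologicalSpace A]
    [AddCommGroup X] [Module ℂ X] [Module A X] [IsScalarTower ℂ A X] [PreHilbertProCStarModule A X]
    [AddCommGroup Y] [Module ℂ Y] [Module A Y] [IsScalarTower ℂ A Y] [PreHilbertProCStarModule A Y]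
    extends X →ₗ[A] Y where
  /-- The adjoint map. -/
  adj : Y → X
  inner_map_left : ∀ (ξ : X) (η : Y), moduleInner A (toFun ξ) η = moduleInner A ξ (adj η)
  bounded : ∀ p : ContCStarSeminorm A, ∃ M : ℝ, 0 < M ∧
    ∀ ξ : X, moduleSeminorm p (toFun ξ) ≤ M * moduleSeminorm p ξ

end HilbertModules

namespace AdjointableOperator

variable {A X Y Z : Type*} [Ring A] [StarRing A] [Algebra ℂ A] [PartialOrder A] [TopologicalSpace A]
  [AddCommGroup X] [Module ℂ X] [Module A X] [IsScalarTower ℂ A X] [PreHilbertProCStarModule A X]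
  [AddCommGroup Y] [Module ℂ Y] [Module A Y] [IsScalarTower ℂ A Y] [PreHilbertProCStarModule A Y]
  [AddCommGroup Z] [Module ℂ Z] [Module A Z] [IsScalarTower ℂ A Z] [PreHilbertProCStarModule A Z]

instance : CoeFun (AdjointableOperator A X Y) (fun _ => X → Y) := ⟨fun T => T.toLinearMap⟩

theorem ext {S T : AdjointableOperator A X Y} (h : ∀ ξ, S ξ = T ξ) : S = T := by
  have hadj : ∀ η, S.adj η = T.adj η := fun η => by
    have key : ∀ ξ : X, moduleInner A ξ (S.adj η) = moduleInner A ξ (T.adj η) := fun ξ => by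
      have h1 := S.inner_map_left ξ η
      have h2 := T.inner_map_left ξ η
      have h3 : S.toFun ξ = T.toFun ξ := h ξ
      rw [← h1, ← h2, h3]
    have key' : ∀ ξ : X, moduleInner A (S.adj η) ξ = moduleInner A (T.adj η) ξ := fun ξ => by
      have := congrArg star (key ξ)
      simpa only [moduleInner, PreHilbertProCStarModule.star_ip] using this
    have hz : moduleInner A (S.adj η - T.adj η) (S.adj η - T.adj η) = 0 := by
      have e := PreHilbertProCStarModule.ip_add_left (A := A) (S.adj η - T.adj η) (T.adj η)
        (S.adj η - T.adj η)
      rw [sub_add_cancel] at e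
      have k := key' (S.adj η - T.adj η)
      simp only [moduleInner] at k ⊢
      rw [k] at e
      simpa using e
    exact sub_eq_zero.1 ((PreHilbertProCStarModule.ip_self_eq_zero _).1 hz)
  have hlin : S.toLinearMap = T.toLinearMap := LinearMap.ext h
  have hadj' : S.adj = T.adj := funext hadj
  cases S
  cases T
  simp only at hlin hadj'
  subst hlin
  subst hadj'
  rfl

/-- Composition of adjointable operators, with `(T ∘ Q)⋆ = Q⋆ ∘ T⋆`. -/
def comp (T : AdjointableOperator A Y Z) (Q : AdjointableOperator A X Y) :
    AdjointableOperator A X Z where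
  toLinearMap := T.toLinearMap.comp Q.toLinearMap
  adj := fun ζ => Q.adj (T.adj ζ)
  inner_map_left := fun ξ ζ =>
    (T.inner_map_left (Q ξ) ζ).trans (Q.inner_map_left ξ (T.adj ζ))
  bounded := fun p => by
    obtain ⟨M, hM, h⟩ := T.bounded p
    obtain ⟨N, hN, k⟩ := Q.bounded p
    refine ⟨M * N, mul_pos hM hN, fun ξ => (h (Q ξ)).trans ?_⟩
    rw [mul_assoc]
    exact mul_le_mul_of_nonneg_left (k ξ) hM.le

/-- A positive operator: `⟨Qξ, ξ⟩ ≥ 0` for all `ξ`. -/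
def IsPositive (Q : AdjointableOperator A X X) : Prop :=
  ∀ ξ : X, 0 ≤ moduleInner A (Q ξ) ξ

/-- `Q = S^(-1/2)`: the operator `S` is invertible, and `Q` is a positive square root of its
inverse `S⁻¹`. -/
def IsInvSqrt (S Q : AdjointableOperator A X X) : Prop :=
  ∃ S' : AdjointableOperator A X X,
    (∀ ξ, S (S' ξ) = ξ) ∧ (∀ ξ, S' (S ξ) = ξ) ∧ Q.IsPositive ∧ ∀ ξ, Q (Q ξ) = S' ξ

end AdjointableOperator

section Frames

variable {A X I : Type*} [Ring A] [StarRing A] [Algebra ℂ A] [PartialOrder A] [TopologicalSpace A]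
  [AddCommGroup X] [Module ℂ X] [Module A X] [IsScalarTower ℂ A X] [PreHilbertProCStarModule A X]

/-- `{T_i}` is a ⋆-operator frame with lower bound `a` and upper bound `b`. The bounds are
strictly nonzero, i.e. `0` does not belong to their spectrum, and the series converges in `A`. -/
structure IsStarOperatorFrameWith (T : I → AdjointableOperator A X X) (a b : A) : Prop where
  lower_strictly_nonzero : (0 : ℂ) ∉ spectrum ℂ a
  upper_strictly_nonzero : (0 : ℂ) ∉ spectrum ℂ b
  summable : ∀ ξ : X, Summable fun i => moduleInner A (T i ξ) (T i ξ)
  lower : ∀ ξ : X, a * moduleInner A ξ ξ * star a ≤ ∑' i, moduleInner A (T i ξ) (T i ξ)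
  upper : ∀ ξ : X, ∑' i, moduleInner A (T i ξ) (T i ξ) ≤ b * moduleInner A ξ ξ * star b

/-- A ⋆-operator frame. -/
def IsStarOperatorFrame (T : I → AdjointableOperator A X X) : Prop :=
  ∃ a b : A, IsStarOperatorFrameWith T a b

/-- A Parseval ⋆-operator frame: both bounds can be taken to be the unit of `A`. -/
def IsParsevalStarOperatorFrame (T : I → AdjointableOperator A X X) : Prop :=
  IsStarOperatorFrameWith T 1 1

/-- `S` is the ⋆-frame operator of `{T_i}`: `Sξ = ∑ T_i⋆ T_i ξ`, with convergence in `X`. -/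
def IsStarFrameOperator [TopologicalSpace X] (T : I → AdjointableOperator A X X)
    (S : AdjointableOperator A X X) : Prop :=
  ∀ ξ : X, HasSum (fun i => (T i).adj (T i ξ)) (S ξ)

end Frames

universe u

/-! The difficulty is to build `S ^ (-1/2)` when neither `A` nor the operators on `X` carry a norm.
Every `p` in `S(A)` is the norm of a ⋆-homomorphism from `A` into a C⋆-algebra, so monotonicity of
`p` and Cauchy–Schwarz (`ContCStarSeminorm.cauchy_schwarz`) come from C⋆-algebras.

Cauchy–Schwarz for the form `∑ ⟨T_i ξ, T_i η⟩` with the upper frame bound makes `∑ T_i⋆ T_i ξ`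
converge to a bounded symmetric `S`. As the lower bound `a` is invertible, `S` is bounded below in
each seminorm.

For fixed `p`, `S` then behaves like a self-adjoint operator with spectrum in some `[c, M]`, `0 <
c`: its shifts by scalars off `[c, M]` are bounded below, and a Banach algebra argument bounds
`q(S)` by the supremum of `|q|` on `[c, M]` (`moduleSeminorm_realAeval_le`). The interval depends on
`p`, so a single sequence of real polynomials is taken that tends to `t ^ (-1/4)` uniformly on each
compact subset of `(0, ∞)`. Its values at `S` converge pointwise to a symmetric `R` with `R⁴ S = 1`.

Put `Q = R²`. It is positive because `⟨Qξ, ξ⟩ = ⟨Rξ, Rξ⟩`, and `R` also yields uniqueness. Finally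
`∑ ⟨T_i Qξ, T_i Qξ⟩ = ⟨QSQξ, ξ⟩ = ⟨ξ, ξ⟩`. -/

open UniformSpace in
/-- The completion of a seminormed algebra is a Banach algebra. -/
@[reducible] noncomputable def UniformSpace.Completion.normedAlgebraOfSeminormedRing (R : Type*)
    [SeminormedRing R] [NormedAlgebra ℂ R] : NormedAlgebra ℂ (Completion R) where
  __ := (inferInstance : Algebra ℂ (Completion R))
  norm_smul_le := norm_smul_le

/-! ### C⋆-seminorms as norms of images in C⋆-algebras. -/

section CStarCompletion

open UniformSpace UniformSpace.Completion

theorem norm_star_of_cstar_identity {R : Type*} [SeminormedRing R] [StarRing R]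
    (h : ∀ x : R, ‖star x * x‖ = ‖x‖ ^ 2) (x : R) : ‖star x‖ = ‖x‖ := by
  have key : ∀ y : R, ‖y‖ ≤ ‖star y‖ := fun y => by
    rcases (norm_nonneg y).eq_or_lt with h0 | h0
    · rw [← h0]
      exact norm_nonneg _
    · have h1 := norm_mul_le (star y) y
      rw [h, sq] at h1
      exact le_of_mul_le_mul_right h1 h0
  refine le_antisymm ?_ (key x)
  simpa using key (star x)

/-- The completion of a seminormed algebra whose seminorm satisfies the C⋆-identity is a
C⋆-algebra. -/
theorem exists_cstarAlgebra_of_cstar_identity {R : Type u} [SeminormedRing R] [StarRing R]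
    [NormedAlgebra ℂ R] [StarModule ℂ R] (h : ∀ x : R, ‖star x * x‖ = ‖x‖ ^ 2) :
    ∃ (C : Type u) (_ : CStarAlgebra C) (φ : R →⋆ₐ[ℂ] C), ∀ x, ‖φ x‖ = ‖x‖ := by
  have hiso : Isometry (star : R → R) :=
    AddMonoidHomClass.isometry_of_norm (starAddEquiv : R ≃+ R).toAddMonoidHom
      (norm_star_of_cstar_identity h)
  -- The involution is isometric, hence extends to the completion; each axiom is a closed condition
  -- that holds on the dense image of `R`.
  set st : Completion R → Completion R := Completion.map star with hst
  have hcoe : ∀ x : R, st x = ((star x : R) : Completion R) :=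
    fun x => Completion.map_coe hiso.uniformContinuous x
  have hc : Continuous st := Completion.continuous_map
  have hinv : ∀ x, st (st x) = x := fun x => by
    induction x using Completion.induction_on with
    | hp => exact isClosed_eq (hc.comp hc) continuous_id
    | ih x => rw [hcoe, hcoe, star_star]
  have hmul : ∀ x y, st (x * y) = st y * st x := fun x y => by
    induction x, y using Completion.induction_on₂ with
    | hp =>
      exact isClosed_eq (hc.comp continuous_mul)
        ((hc.comp continuous_snd).mul (hc.comp continuous_fst))
    | ih x y => rw [hcoe, hcoe, ← Completion.coe_mul, hcoe, star_mul, Completion.coe_mul]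
  have hadd : ∀ x y, st (x + y) = st x + st y := fun x y => by
    induction x, y using Completion.induction_on₂ with
    | hp =>
      exact isClosed_eq (hc.comp continuous_add)
        ((hc.comp continuous_fst).add (hc.comp continuous_snd))
    | ih x y => rw [hcoe, hcoe, ← Completion.coe_add, hcoe, star_add, Completion.coe_add]
  have hnorm : ∀ x, ‖x‖ * ‖x‖ ≤ ‖st x * x‖ := fun x => by
    induction x using Completion.induction_on with
    | hp =>
      exact isClosed_le (continuous_norm.mul continuous_norm) ((hc.mul continuous_id).norm)
    | ih x => rw [hcoe, ← Completion.coe_mul, Completion.norm_coe, Completion.norm_coe, h, sq]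
  have hsmul : ∀ (c : ℂ) x, st (c • x) = star c • st x := fun c x => by
    induction x using Completion.induction_on with
    | hp =>
      exact isClosed_eq (hc.comp (continuous_const_smul c))
        ((continuous_const_smul (star c)).comp hc)
    | ih x => rw [hcoe, ← Completion.coe_smul, hcoe, star_smul, Completion.coe_smul]
  let _ : StarRing (Completion R) :=
    { star := st
      star_involutive := hinv
      star_mul := hmul
      star_add := hadd }
  let _ : NormedAlgebra ℂ (Completion R) := normedAlgebraOfSeminormedRing R
  let _ : CStarAlgebra (Completion R) :=
    { norm_mul_self_le := hnorm
      star_smul := hsmul }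
  exact ⟨Completion R, inferInstance,
    { Completion.coeRingHom with
      commutes' := fun c => rfl
      map_star' := fun x => (hcoe x).symm }, fun x => Completion.norm_coe x⟩

end CStarCompletion

/-- A C⋆-seminorm is the norm of the image under a ⋆-homomorphism into a C⋆-algebra. -/
theorem exists_starAlgHom_norm_eq {R : Type u} [Ring R] [StarRing R] [Algebra ℂ R] [StarModule ℂ R]
    (p : Seminorm ℂ R) (hmul : ∀ a b, p (a * b) ≤ p a * p b)
    (hstar : ∀ a, p (star a * a) = p a ^ 2) :
    ∃ (C : Type u) (_ : CStarAlgebra C) (φ : R →⋆ₐ[ℂ] C), ∀ x, ‖φ x‖ = p x := by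
  let g : SeminormedAddCommGroup R := AddGroupSeminorm.toSeminormedAddCommGroup p.toAddGroupSeminorm
  let : SeminormedRing R :=
    { g, (inferInstance : Ring R) with norm_mul_le := hmul }
  let : NormedAlgebra ℂ R :=
    { (inferInstance : Algebra ℂ R) with norm_smul_le := fun c x => (map_smul_eq_mul p c x).le }
  exact exists_cstarAlgebra_of_cstar_identity hstar

/-! ### Monotonicity and Cauchy–Schwarz for continuous C⋆-seminorms. -/

namespace ContCStarSeminorm

variable {A : Type u} [Ring A] [StarRing A] [Algebra ℂ A] [TopologicalSpace A]
  (p : ContCStarSeminorm A)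

theorem exists_starAlgHom [StarModule ℂ A] :
    ∃ (C : Type u) (_ : CStarAlgebra C) (φ : A →⋆ₐ[ℂ] C), ∀ x, ‖φ x‖ = p x :=
  exists_starAlgHom_norm_eq p.toSeminorm p.mul_le' p.star_mul_self'

theorem nonneg (a : A) : 0 ≤ p a := apply_nonneg p.toSeminorm a

theorem add_le (a b : A) : p (a + b) ≤ p a + p b := map_add_le_add p.toSeminorm a b

theorem star_eq [StarModule ℂ A] (a : A) : p (star a) = p a := by
  obtain ⟨C, _, φ, hφ⟩ := p.exists_starAlgHom
  rw [← hφ, ← hφ, map_star, norm_star]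

variable [PartialOrder A] [StarOrderedRing A] [StarModule ℂ A]

/-- A ⋆-homomorphism between star-ordered rings preserves the order, which reduces the claim to a
C⋆-algebra. -/
theorem mono {a b : A} (ha : 0 ≤ a) (hab : a ≤ b) : p a ≤ p b := by
  obtain ⟨C, _, φ, hφ⟩ := p.exists_starAlgHom
  let _ := CStarAlgebra.spectralOrder C
  have := CStarAlgebra.spectralOrderedRing C
  rw [← hφ, ← hφ]
  refine CStarAlgebra.norm_le_norm_of_nonneg_of_le ?_ (OrderHomClass.mono φ hab)
  simpa using OrderHomClass.mono φ ha

/-- The Cauchy–Schwarz inequality for a positive semidefinite `A`-valued form. -/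
theorem cauchy_schwarz {X : Type*} [AddCommGroup X] [Module A X] (β : X → X → A)
    (hadd : ∀ ξ ζ η, β (ξ + ζ) η = β ξ η + β ζ η) (hsmul : ∀ (a : A) ξ η, β (a • ξ) η = a * β ξ η)
    (hstar : ∀ ξ η, star (β ξ η) = β η ξ) (hnonneg : ∀ ξ, 0 ≤ β ξ ξ) (ξ η : X) :
    p (β ξ η) ^ 2 ≤ p (β ξ ξ) * p (β η η) := by
  have hadd' : ∀ ξ ζ η, β ξ (ζ + η) = β ξ ζ + β ξ η := fun ξ ζ η => by
    rw [← hstar, hadd, star_add, hstar, hstar]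
  have hsmul' : ∀ (a : A) ξ η, β ξ (a • η) = β ξ η * star a := fun a ξ η => by
    rw [← hstar, hsmul, star_mul, hstar]
  obtain ⟨C, _, φ, hφ⟩ := p.exists_starAlgHom
  let _ := CStarAlgebra.spectralOrder C
  have := CStarAlgebra.spectralOrderedRing C
  have hpos : ∀ ζ, 0 ≤ φ (β ζ ζ) := fun ζ => by
    simpa using OrderHomClass.mono φ (hnonneg ζ)
  -- A strict upper bound `N` is positive and can be cancelled even if `p (β ξ ξ) = 0`; at the end
  -- `N` decreases to `p (β ξ ξ)`.
  have key : ∀ N : ℝ, p (β ξ ξ) < N → p (β ξ η) ^ 2 ≤ N * p (β η η) := fun N hN => by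
    have hN0 : 0 < N := (p.nonneg _).trans_lt hN
    set a : A := β η ξ with ha
    have hexp : β (a • ξ + (-algebraMap ℂ A N) • η) (a • ξ + (-algebraMap ℂ A N) • η)
        = a * β ξ ξ * star a - (2 * (N : ℂ)) • (a * star a) + ((N : ℂ) ^ 2) • β η η := by
      have hsN : star (algebraMap ℂ A N) = algebraMap ℂ A N := by
        rw [← algebraMap_star_comm]
        simp
      have hsa : β ξ η = star a := by rw [ha, hstar]
      have hl : ∀ x : A, algebraMap ℂ A N * x = (N : ℂ) • x := fun x => (Algebra.smul_def _ x).symm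
      have hr : ∀ x : A, x * algebraMap ℂ A N = (N : ℂ) • x := fun x => by
        rw [← Algebra.commutes, hl]
      simp only [hadd, hadd', hsmul, hsmul', star_neg, hsN, ← ha, hsa, neg_mul, mul_neg, hl, hr,
        mul_smul_comm, mul_assoc]
      module
    have h0 := hpos (a • ξ + (-algebraMap ℂ A N) • η)
    rw [hexp, map_add, map_sub, map_mul, map_mul, map_smul, map_smul, map_mul, map_star] at h0
    -- With this bound, positivity of the form at `a • ξ - N • η` becomes `N a a⋆ ≤ N² β η η` in the
    -- C⋆-algebra.
    have h1 : φ a * φ (β ξ ξ) * star (φ a) ≤ N • (φ a * star (φ a)) := by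
      refine (CStarAlgebra.star_right_conjugate_le_norm_smul (hpos ξ).isSelfAdjoint).trans ?_
      refine smul_le_smul_of_nonneg_right ?_ (mul_star_self_nonneg _)
      rw [hφ]
      exact hN.le
    have hc1 : (2 * (N : ℂ)) • (φ a * star (φ a)) = (2 * N) • (φ a * star (φ a)) := by
      rw [← Complex.coe_smul]; push_cast; rfl
    have hc2 : ((N : ℂ) ^ 2) • φ (β η η) = (N ^ 2) • φ (β η η) := by
      rw [← Complex.coe_smul]; push_cast; rfl
    rw [hc1, hc2] at h0
    have h2 : N • (φ a * star (φ a)) ≤ (N ^ 2) • φ (β η η) := by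
      have h3 : 0 ≤ N • (φ a * star (φ a)) - (2 * N) • (φ a * star (φ a)) + (N ^ 2) • φ (β η η) :=
        h0.trans (by gcongr)
      rw [← sub_nonneg]
      convert h3 using 1
      module
    have h4 := CStarAlgebra.norm_le_norm_of_nonneg_of_le
      (smul_nonneg hN0.le (mul_star_self_nonneg (φ a))) h2
    rw [norm_smul, norm_smul, CStarRing.norm_self_mul_star, hφ, hφ, Real.norm_of_nonneg hN0.le,
      Real.norm_of_nonneg (sq_nonneg N)] at h4
    have hsa : p (β ξ η) = p a := by rw [← hstar, star_eq]
    rw [hsa]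
    have : N * (p a ^ 2) ≤ N * (N * p (β η η)) := by nlinarith
    exact le_of_mul_le_mul_left this hN0
  have hlim : Tendsto (fun N : ℝ => N * p (β η η)) (𝓝[>] (p (β ξ ξ)))
      (𝓝 (p (β ξ ξ) * p (β η η))) :=
    ((continuous_id.mul continuous_const).tendsto _).mono_left nhdsWithin_le_nhds
  exact ge_of_tendsto hlim (eventually_mem_nhdsWithin.mono fun N hN => key N hN)

end ContCStarSeminorm

/-! ### Spectra and polynomial bounds from lower bounds on shifts. -/

section BanachAlgebra

variable {B : Type*} [NormedRing B] [NormedAlgebra ℂ B] [CompleteSpace B]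

/-- An element bounded below under left multiplication and approximated by invertible shifts
is invertible. -/
theorem isUnit_of_bounded_below {s : B} {m : ℝ} (hs : ∀ x : B, ‖x‖ ≤ m * ‖s * x‖)
    (hu : ∃ᶠ z : ℂ in 𝓝 0, IsUnit (s - algebraMap ℂ B z)) : IsUnit s := by
  -- `K` dominates the norm of `v = (s - z)⁻¹` for small `z`: from `s * v = 1 + z • v` one gets `‖v‖
  -- ≤ |m| (‖1‖ + ‖z‖ ‖v‖)`, and `‖z‖ |m| ≤ 1/2` absorbs the last term. Then `‖z • v‖ < 1` makes `s
  -- * v` a unit.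
  set K : ℝ := 2 * |m| * ‖(1 : B)‖ + 1
  have hK : 0 < K := by positivity
  have hev : ∀ᶠ z : ℂ in 𝓝 0, ‖z‖ * |m| ≤ 1 / 2 ∧ ‖z‖ * K < 1 := by
    have h1 : Tendsto (fun z : ℂ => ‖z‖ * |m|) (𝓝 0) (𝓝 0) := by
      simpa using (continuous_norm.mul continuous_const).tendsto (0 : ℂ)
        (f := fun z : ℂ => ‖z‖ * |m|)
    have h2 : Tendsto (fun z : ℂ => ‖z‖ * K) (𝓝 0) (𝓝 0) := by
      simpa using (continuous_norm.mul continuous_const).tendsto (0 : ℂ)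
        (f := fun z : ℂ => ‖z‖ * K)
    exact (h1.eventually_le_const (by norm_num)).and (h2.eventually_lt_const (by norm_num))
  obtain ⟨z, ⟨u, hu⟩, hz1, hz2⟩ := (hu.and_eventually hev).exists
  have hsu : s = u + algebraMap ℂ B z := by rw [hu]; abel
  set v : B := ↑u⁻¹ with hv
  have hsv : s * v = 1 + z • v := by
    rw [hsu, add_mul, hv, Units.mul_inv, Algebra.smul_def]
  have hvn : ‖v‖ ≤ 2 * |m| * ‖(1 : B)‖ := by
    have h1 : ‖v‖ ≤ |m| * (‖(1 : B)‖ + ‖z‖ * ‖v‖) :=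
      calc ‖v‖ ≤ m * ‖s * v‖ := hs v
        _ ≤ |m| * ‖s * v‖ := by gcongr; exact le_abs_self m
        _ ≤ _ := by
          gcongr
          rw [hsv]
          exact (norm_add_le _ _).trans (by rw [norm_smul])
    nlinarith [mul_le_mul_of_nonneg_right hz1 (norm_nonneg v)]
  have hlt : ‖-(z • v)‖ < 1 := by
    rw [norm_neg, norm_smul]
    exact (mul_le_mul_of_nonneg_left (hvn.trans (by simp [K])) (norm_nonneg z)).trans_lt hz2
  have h1 : IsUnit (s * v) := by
    rw [hsv, ← sub_neg_eq_add]
    exact (Units.oneSub _ hlt).isUnit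
  have h2 : s = s * v * u := by rw [mul_assoc, hv, Units.inv_mul, mul_one]
  rw [h2]
  exact h1.mul u.isUnit

/-- On a vertical line, a point of the compact spectrum farthest out in one direction is a limit of
resolvent points. If the shift there were bounded below, `isUnit_of_bounded_below` would make it
invertible. -/
theorem spectrum_subset_of_bounded_below {s : B} {K : Set ℂ} (hK : ∀ z ∈ K, z.im = 0)
    (hs : ∀ z ∉ K, ∃ m : ℝ, ∀ x : B, ‖x‖ ≤ m * ‖(s - algebraMap ℂ B z) * x‖) :
    spectrum ℂ s ⊆ K := by
  intro w hw
  by_contra hwK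
  -- `σ` points away from the real axis, so that the extremal point `y` above or below `w` can be
  -- real only if `y = w`; hence `y ∉ K`.
  obtain ⟨σ, hσ, hσw⟩ : ∃ σ : ℝ, (σ = 1 ∨ σ = -1) ∧ 0 ≤ σ * w.im := by
    rcases le_total 0 w.im with h | h
    · exact ⟨1, .inl rfl, by linarith⟩
    · exact ⟨-1, .inr rfl, by linarith⟩
  have hcpt : IsCompact (spectrum ℂ s ∩ {z : ℂ | z.re = w.re}) :=
    (spectrum.isCompact s).inter_right (isClosed_eq Complex.continuous_re continuous_const)
  obtain ⟨y, ⟨hy, hyre⟩, hmax⟩ := hcpt.exists_isMaxOn ⟨w, hw, rfl⟩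
    (f := fun z : ℂ => σ * z.im) (by fun_prop)
  have hwy : σ * w.im ≤ σ * y.im := hmax ⟨hw, rfl⟩
  have hσ2 : σ * σ = 1 := by rcases hσ with h | h <;> rw [h] <;> norm_num
  have hyK : y ∉ K := fun h => by
    have hy0 := hK y h
    rw [hy0, mul_zero] at hwy
    have hw0 : w.im = 0 := by
      have h0 : σ * w.im = 0 := le_antisymm hwy hσw
      have : σ * (σ * w.im) = 0 := by rw [h0, mul_zero]
      rwa [← mul_assoc, hσ2, one_mul] at this
    exact hwK ((Complex.ext hyre (hy0.trans hw0.symm) : y = w) ▸ h)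
  obtain ⟨m, hm⟩ := hs y hyK
  have hneg : ∀ x : B, ‖x‖ ≤ m * ‖(algebraMap ℂ B y - s) * x‖ := fun x => by
    have := hm x
    rwa [← norm_neg (_ * x), ← neg_mul, neg_sub] at this
  refine hy (isUnit_of_bounded_below hneg ?_)
  -- The points `y + tσi` with `t > 0` lie beyond `y`, hence outside the spectrum by maximality.
  have ht : Tendsto (fun t : ℝ => -((t * σ : ℝ) : ℂ) * Complex.I) (𝓝[>] 0) (𝓝 0) := by
    have : Continuous fun t : ℝ => -((t * σ : ℝ) : ℂ) * Complex.I := by fun_prop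
    simpa using (this.tendsto 0).mono_left nhdsWithin_le_nhds
  refine ht.frequently (Eventually.frequently ?_)
  filter_upwards [eventually_mem_nhdsWithin] with t (ht0 : 0 < t)
  by_contra hnu
  have hmem : y + ((t * σ : ℝ) : ℂ) * Complex.I ∈ spectrum ℂ s := by
    intro h
    apply hnu
    rw [spectrum.mem_resolventSet_iff, map_add] at h
    rw [neg_mul, map_neg, sub_neg_eq_add, sub_add_eq_add_sub]
    exact h
  have := hmax (a := y + ((t * σ : ℝ) : ℂ) * Complex.I) ⟨hmem, by simpa using hyre⟩
  simp only [Set.mem_ofPred_eq, Complex.add_im, Complex.mul_im, Complex.ofReal_re, Complex.I_im,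
    Complex.ofReal_im, Complex.I_re] at this
  nlinarith

/-- If the norm of `x` is multiplicative on the powers `x ^ 2 ^ n`, it is at most any bound of the
spectrum. -/
theorem norm_le_of_forall_mem_spectrum {x : B} (hx : ∀ n : ℕ, ‖x ^ 2 ^ n‖ = ‖x‖ ^ 2 ^ n)
    {r : ℝ} (hr : 0 ≤ r) (h : ∀ z ∈ spectrum ℂ x, ‖z‖ ≤ r) : ‖x‖ ≤ r := by
  have hrad : spectralRadius ℂ x = ‖x‖₊ := by
    -- Gelfand's formula along the exponents `2 ^ n`, where the sequence is constant.
    refine tendsto_nhds_unique ((spectrum.pow_nnnorm_pow_one_div_tendsto_nhds_spectralRadius x).comp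
      (tendsto_pow_atTop_atTop_of_one_lt one_lt_two)) ?_
    refine tendsto_const_nhds.congr fun n => ?_
    have hn : ‖x ^ 2 ^ n‖₊ = ‖x‖₊ ^ 2 ^ n := NNReal.eq (hx n)
    rw [Function.comp_apply, hn, ENNReal.coe_pow, ← ENNReal.rpow_natCast, ← ENNReal.rpow_mul]
    simp
  have hle : spectralRadius ℂ x ≤ (r.toNNReal : ENNReal) := by
    refine iSup₂_le fun z hz => ?_
    have : ‖z‖₊ ≤ r.toNNReal := by
      rw [← NNReal.coe_le_coe, Real.coe_toNNReal r hr]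
      exact h z hz
    exact_mod_cast this
  rw [hrad] at hle
  have : ‖x‖₊ ≤ r.toNNReal := by exact_mod_cast hle
  rw [← NNReal.coe_le_coe, Real.coe_toNNReal r hr] at this
  exact this

/-- The norm of a real polynomial in an element whose powers behave as those of a self-adjoint
element and whose shifts by `z ∉ [c, M]` are bounded below. -/
theorem norm_aeval_le_of_bounded_below {s : B} {c M r : ℝ}
    (hs : ∀ z : ℂ, (∀ t : ℝ, t ∈ Set.Icc c M → z ≠ t) →
      ∃ m : ℝ, ∀ x : B, ‖x‖ ≤ m * ‖(s - algebraMap ℂ B z) * x‖)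
    (hsq : ∀ q : Polynomial ℝ, ‖Polynomial.aeval s (q.map (algebraMap ℝ ℂ))‖ ^ 2 ≤
      ‖Polynomial.aeval s ((q ^ 2).map (algebraMap ℝ ℂ))‖)
    (hr : 0 ≤ r) (q : Polynomial ℝ) (hq : ∀ t ∈ Set.Icc c M, |q.eval t| ≤ r) :
    ‖Polynomial.aeval s (q.map (algebraMap ℝ ℂ))‖ ≤ r := by
  have hspec : spectrum ℂ s ⊆ (fun t : ℝ => (t : ℂ)) '' Set.Icc c M := by
    refine spectrum_subset_of_bounded_below ?_ fun z hz => hs z fun t ht h => hz ⟨t, ht, h.symm⟩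
    rintro _ ⟨t, -, rfl⟩
    exact Complex.ofReal_im t
  refine norm_le_of_forall_mem_spectrum (fun n => ?_) hr ?_
  · induction n with
    | zero => simp
    | succ n ih =>
      rw [pow_succ 2 n, pow_mul, pow_mul, ← ih]
      refine le_antisymm ?_ ?_
      · rw [sq, sq]
        exact norm_mul_le _ _
      -- `hsq` replaces the C⋆-identity, since no involution on `B` is available.
      · have := hsq (q ^ 2 ^ n)
        simp only [Polynomial.map_pow, map_pow (Polynomial.aeval s)] at this
        exact this
  · nontriviality B
    intro z hz
    rw [spectrum.map_polynomial_aeval_of_nonempty _ _ (spectrum.nonempty s)] at hz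
    obtain ⟨w, hw, rfl⟩ := hz
    obtain ⟨t, ht, rfl⟩ := hspec hw
    have : Polynomial.eval ((t : ℝ) : ℂ) (q.map (algebraMap ℝ ℂ)) = ((q.eval t : ℝ) : ℂ) :=
      (Polynomial.eval_map _ _).trans (Polynomial.eval₂_at_apply (algebraMap ℝ ℂ) t)
    simp only [this, Complex.norm_real, Real.norm_eq_abs]
    exact hq t ht

end BanachAlgebra

open UniformSpace in
/-- `norm_aeval_le_of_bounded_below` without completeness. -/
theorem norm_aeval_le_of_bounded_below' {R : Type*} [SeminormedRing R] [NormedAlgebra ℂ R]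
    {s : R} {c M r : ℝ}
    (hs : ∀ z : ℂ, (∀ t : ℝ, t ∈ Set.Icc c M → z ≠ t) →
      ∃ m : ℝ, ∀ x : R, ‖x‖ ≤ m * ‖(s - algebraMap ℂ R z) * x‖)
    (hsq : ∀ q : Polynomial ℝ, ‖Polynomial.aeval s (q.map (algebraMap ℝ ℂ))‖ ^ 2 ≤
      ‖Polynomial.aeval s ((q ^ 2).map (algebraMap ℝ ℂ))‖)
    (hr : 0 ≤ r) (q : Polynomial ℝ) (hq : ∀ t ∈ Set.Icc c M, |q.eval t| ≤ r) :
    ‖Polynomial.aeval s (q.map (algebraMap ℝ ℂ))‖ ≤ r := by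
  let _ : NormedAlgebra ℂ (Completion R) := Completion.normedAlgebraOfSeminormedRing _
  let κ : R →ₐ[ℂ] Completion R := { Completion.coeRingHom with commutes' := fun _ => rfl }
  have hκ : ∀ T, ‖κ T‖ = ‖T‖ := fun T => Completion.norm_coe T
  have hnorm : ∀ f : Polynomial ℂ, ‖Polynomial.aeval (κ s) f‖ = ‖Polynomial.aeval s f‖ :=
    fun f => by rw [Polynomial.aeval_algHom_apply, hκ]
  rw [← hnorm]
  refine norm_aeval_le_of_bounded_below (c := c) (M := M) (fun z hz => ?_) (fun q => ?_) hr q hq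
  · obtain ⟨m, hm⟩ := hs z hz
    refine ⟨m, fun x => ?_⟩
    induction x using Completion.induction_on with
    | hp =>
      exact isClosed_le continuous_norm
        (continuous_const.mul (continuous_norm.comp (continuous_const_mul _)))
    | ih T =>
      change ‖κ T‖ ≤ m * ‖(κ s - algebraMap ℂ _ z) * κ T‖
      rw [← κ.commutes, ← map_sub, ← map_mul, hκ, hκ]
      exact hm T
  · rw [hnorm, hnorm]
    exact hsq q

/-- The estimate of `‖q(S)‖` by the values of `q` on `[c, M]`, for a linear map `S` which behaves,
with respect to the seminorm `P`, as a self-adjoint operator with spectrum in `[c, M]`. -/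
theorem Seminorm.aeval_le_of_bounded_below {X : Type*} [AddCommGroup X] [Module ℂ X]
    (P : Seminorm ℂ X) (S : Module.End ℂ X) {c M r : ℝ} (hM : ∀ ξ, P (S ξ) ≤ M * P ξ)
    (hs : ∀ z : ℂ, (∀ t : ℝ, t ∈ Set.Icc c M → z ≠ t) →
      ∃ m : ℝ, ∀ ξ, P ξ ≤ m * P (S ξ - z • ξ))
    (hsq : ∀ (q : Polynomial ℝ) (ξ : X), P (Polynomial.aeval S (q.map (algebraMap ℝ ℂ)) ξ) ^ 2 ≤
      P (Polynomial.aeval S ((q ^ 2).map (algebraMap ℝ ℂ)) ξ) * P ξ)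
    (hr : 0 ≤ r) (q : Polynomial ℝ) (hq : ∀ t ∈ Set.Icc c M, |q.eval t| ≤ r) (ξ : X) :
    P (Polynomial.aeval S (q.map (algebraMap ℝ ℂ)) ξ) ≤ r * P ξ := by
  let _ : SeminormedAddCommGroup X := AddGroupSeminorm.toSeminormedAddCommGroup P.toAddGroupSeminorm
  let _ : NormedSpace ℂ X := { norm_smul_le := fun a x => (map_smul_eq_mul P a x).le }
  -- `S` is placed in the seminormed algebra of `P`-bounded operators; the vector estimates `hs` and
  -- `hsq` turn into estimates of operator seminorms there.
  let S' : X →L[ℂ] X := S.mkContinuous M hM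
  let ι : (X →L[ℂ] X) →ₐ[ℂ] Module.End ℂ X := 
    { toFun := fun T => T.toLinearMap
      map_one' := rfl
      map_mul' := fun _ _ => rfl
      map_zero' := rfl
      map_add' := fun _ _ => rfl
      commutes' := fun _ => rfl }
  have happ : ∀ (f : Polynomial ℂ) (x : X),
      Polynomial.aeval S' f x = Polynomial.aeval S f x := fun f x => by
    have h := Polynomial.aeval_algHom_apply ι S' f
    exact (LinearMap.congr_fun h x).symm
  have key := norm_aeval_le_of_bounded_below' (s := S') (c := c) (M := M) (r := r) ?_ ?_ hr q hq
  · have := ContinuousLinearMap.le_of_opNorm_le _ key ξ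
    rwa [happ] at this
  · intro z hz
    obtain ⟨m, hm⟩ := hs z hz
    refine ⟨|m|, fun T => ?_⟩
    refine T.opNorm_le_bound (by positivity) fun x => ?_
    calc ‖T x‖ ≤ m * ‖S (T x) - z • T x‖ := hm (T x)
      _ ≤ |m| * ‖S (T x) - z • T x‖ := by gcongr; exact le_abs_self m
      _ ≤ |m| * (‖(S' - algebraMap ℂ _ z) * T‖ * ‖x‖) := by
        gcongr
        exact ((S' - algebraMap ℂ _ z) * T).le_opNorm x
      _ = _ := (mul_assoc _ _ _).symm
  · intro q
    set T := Polynomial.aeval S' (q.map (algebraMap ℝ ℂ))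
    set U := Polynomial.aeval S' ((q ^ 2).map (algebraMap ℝ ℂ))
    have h1 : ‖T‖ ≤ √‖U‖ := by
      refine T.opNorm_le_bound (Real.sqrt_nonneg _) fun x => ?_
      refine le_of_sq_le_sq ?_ (by positivity)
      rw [mul_pow, Real.sq_sqrt (norm_nonneg _)]
      have h2 : ‖T x‖ ^ 2 ≤ ‖U x‖ * ‖x‖ := by
        simp only [T, U, happ]
        exact hsq q x
      have h3 := U.le_opNorm x
      nlinarith [norm_nonneg x]
    calc ‖T‖ ^ 2 ≤ √‖U‖ ^ 2 := by gcongr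
      _ = ‖U‖ := Real.sq_sqrt (norm_nonneg _)

/-! ### Algebra of the inner product and its seminorms. -/

section InnerProduct

variable {A : Type u} {X : Type*} [Ring A] [StarRing A] [Algebra ℂ A] [PartialOrder A]
  [AddCommGroup X] [Module ℂ X] [Module A X] [IsScalarTower ℂ A X] [PreHilbertProCStarModule A X]

theorem moduleInner_add_left (ξ ζ η : X) :
    moduleInner A (ξ + ζ) η = moduleInner A ξ η + moduleInner A ζ η :=
  PreHilbertProCStarModule.ip_add_left ξ ζ η

theorem moduleInner_smul_left (a : A) (ξ η : X) : moduleInner A (a • ξ) η = a * moduleInner A ξ η :=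
  PreHilbertProCStarModule.ip_smul_left a ξ η

theorem moduleInner_csmul_left (c : ℂ) (ξ η : X) : moduleInner A (c • ξ) η = c • moduleInner A ξ η :=
  PreHilbertProCStarModule.ip_csmul_left c ξ η

theorem star_moduleInner (ξ η : X) : star (moduleInner A ξ η) = moduleInner A η ξ :=
  PreHilbertProCStarModule.star_ip ξ η

theorem moduleInner_self_nonneg (ξ : X) : 0 ≤ moduleInner A ξ ξ :=
  PreHilbertProCStarModule.ip_self_nonneg ξ

theorem moduleInner_self_eq_zero {ξ : X} : moduleInner A ξ ξ = 0 ↔ ξ = 0 :=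
  PreHilbertProCStarModule.ip_self_eq_zero ξ

theorem moduleInner_add_right (ξ ζ η : X) :
    moduleInner A ξ (ζ + η) = moduleInner A ξ ζ + moduleInner A ξ η := by
  rw [← star_moduleInner, moduleInner_add_left, star_add, star_moduleInner, star_moduleInner]

theorem moduleInner_smul_right (a : A) (ξ η : X) :
    moduleInner A ξ (a • η) = moduleInner A ξ η * star a := by
  rw [← star_moduleInner, moduleInner_smul_left, star_mul, star_moduleInner]

theorem moduleInner_csmul_right [StarModule ℂ A] (c : ℂ) (ξ η : X) :
    moduleInner A ξ (c • η) = star c • moduleInner A ξ η := by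
  rw [← star_moduleInner, moduleInner_csmul_left, star_smul, star_moduleInner]

theorem moduleInner_neg_left (ξ η : X) : moduleInner A (-ξ) η = -moduleInner A ξ η := by
  simpa using moduleInner_csmul_left (A := A) (-1) ξ η

theorem moduleInner_sub_left (ξ ζ η : X) :
    moduleInner A (ξ - ζ) η = moduleInner A ξ η - moduleInner A ζ η := by
  rw [sub_eq_add_neg, moduleInner_add_left, moduleInner_neg_left, sub_eq_add_neg]

theorem moduleInner_sub_right (ξ ζ η : X) :
    moduleInner A ξ (ζ - η) = moduleInner A ξ ζ - moduleInner A ξ η := by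
  rw [← star_moduleInner, moduleInner_sub_left, star_sub, star_moduleInner, star_moduleInner]

theorem moduleInner_zero_left (η : X) : moduleInner A (0 : X) η = 0 := by
  simpa using moduleInner_csmul_left (A := A) 0 (0 : X) η

theorem moduleInner_sum_left {ι : Type*} (s : Finset ι) (f : ι → X) (η : X) :
    moduleInner A (∑ i ∈ s, f i) η = ∑ i ∈ s, moduleInner A (f i) η :=
  map_sum (⟨⟨fun ξ => moduleInner A ξ η, moduleInner_zero_left η⟩,
    fun ξ ζ => moduleInner_add_left ξ ζ η⟩ : X →+ A) f s

theorem ext_moduleInner_left {ξ ζ : X} (h : ∀ η : X, moduleInner A ξ η = moduleInner A ζ η) : ξ = ζ := by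
  rw [← sub_eq_zero, ← moduleInner_self_eq_zero (A := A), moduleInner_sub_left, h, sub_self]

variable [TopologicalSpace A] (p : ContCStarSeminorm A)

theorem moduleSeminorm_nonneg (ξ : X) : 0 ≤ moduleSeminorm p ξ := Real.sqrt_nonneg _

theorem moduleSeminorm_sq (ξ : X) : moduleSeminorm p ξ ^ 2 = p (moduleInner A ξ ξ) :=
  Real.sq_sqrt (p.nonneg _)

variable [StarModule ℂ A]

theorem moduleSeminorm_smul_le (a : A) (ξ : X) :
    moduleSeminorm p (a • ξ) ≤ p a * moduleSeminorm p ξ := by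
  refine le_of_sq_le_sq ?_ (mul_nonneg (p.nonneg a) (moduleSeminorm_nonneg p ξ))
  rw [mul_pow, moduleSeminorm_sq, moduleSeminorm_sq, moduleInner_smul_left, moduleInner_smul_right,
    ← mul_assoc]
  have h1 := p.mul_le' (a * moduleInner A ξ ξ) (star a)
  have h2 := p.mul_le' a (moduleInner A ξ ξ)
  have h3 := p.star_eq a
  have h4 := p.nonneg a
  rw [h3] at h1
  nlinarith

variable [StarOrderedRing A]

theorem moduleInner_le_moduleSeminorm_mul (ξ η : X) :
    p (moduleInner A ξ η) ≤ moduleSeminorm p ξ * moduleSeminorm p η := by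
  refine le_of_sq_le_sq ?_ (mul_nonneg (moduleSeminorm_nonneg p ξ) (moduleSeminorm_nonneg p η))
  rw [mul_pow, moduleSeminorm_sq, moduleSeminorm_sq]
  exact p.cauchy_schwarz (moduleInner A) moduleInner_add_left moduleInner_smul_left star_moduleInner
    moduleInner_self_nonneg ξ η

theorem moduleSeminorm_le_of_inner_le {ξ η : X} (h : moduleInner A ξ ξ ≤ moduleInner A η η) :
    moduleSeminorm p ξ ≤ moduleSeminorm p η :=
  Real.sqrt_le_sqrt (p.mono (moduleInner_self_nonneg ξ) h)

/-- `moduleSeminorm p` as a bundled seminorm. -/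
noncomputable def ContCStarSeminorm.onModule (X : Type*) [AddCommGroup X] [Module ℂ X] [Module A X]
    [IsScalarTower ℂ A X] [PreHilbertProCStarModule A X] : Seminorm ℂ X :=
  Seminorm.of (moduleSeminorm p) (fun ξ η => by
      have h0 := moduleSeminorm_nonneg p ξ
      have h1 := moduleSeminorm_nonneg p η
      refine le_of_sq_le_sq ?_ (by positivity)
      rw [moduleSeminorm_sq, moduleInner_add_left, moduleInner_add_right, moduleInner_add_right]
      have h2 := p.add_le (moduleInner A ξ ξ + moduleInner A ξ η)
        (moduleInner A η ξ + moduleInner A η η)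
      have h3 := p.add_le (moduleInner A ξ ξ) (moduleInner A ξ η)
      have h4 := p.add_le (moduleInner A η ξ) (moduleInner A η η)
      have h5 := moduleInner_le_moduleSeminorm_mul p ξ η
      have h6 := moduleInner_le_moduleSeminorm_mul p η ξ
      have h7 := moduleSeminorm_sq p ξ
      have h8 := moduleSeminorm_sq p η
      nlinarith) (fun c ξ => by
      rw [← sq_eq_sq₀ (moduleSeminorm_nonneg p _)
        (mul_nonneg (norm_nonneg _) (moduleSeminorm_nonneg p _)), mul_pow, moduleSeminorm_sq,
        moduleSeminorm_sq, moduleInner_csmul_left, moduleInner_csmul_right, smul_smul]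
      have := map_smul_eq_mul p.toSeminorm (c * star c) (moduleInner A ξ ξ)
      rw [norm_mul, norm_star, ← sq] at this
      exact this)

/-- Symmetric operators: `⟨Lξ, η⟩ = ⟨ξ, Lη⟩`. -/
def IsModuleSymmetric (A : Type*) {X : Type*} [Ring A] [StarRing A] [Algebra ℂ A] [PartialOrder A]
    [AddCommGroup X] [Module ℂ X] [Module A X] [IsScalarTower ℂ A X] [PreHilbertProCStarModule A X]
    (L : X → X) : Prop :=
  ∀ ξ η : X, moduleInner A (L ξ) η = moduleInner A ξ (L η)

end InnerProduct

/-! ### Real polynomials in a module map. -/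

section Polynomial

variable {A : Type u} {X : Type*} [Ring A] [Algebra ℂ A]
  [AddCommGroup X] [Module ℂ X] [Module A X] [IsScalarTower ℂ A X]

/-- Real polynomials in an `A`-linear map. -/
noncomputable def realAeval (S : X →ₗ[A] X) : Polynomial ℝ →+* (X →ₗ[A] X) :=
  haveI : SMulCommClass ℂ A X := IsScalarTower.to_smulCommClass
  haveI : SMulCommClass A ℂ X := SMulCommClass.symm _ _ _
  ((Polynomial.aeval (R := ℂ) (A := Module.End A X) S : _ →ₐ[ℂ] _) : Polynomial ℂ →+* _).comp
    (Polynomial.mapRingHom (algebraMap ℝ ℂ))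

theorem realAeval_X (S : X →ₗ[A] X) : realAeval S Polynomial.X = S := by
  simp [realAeval]

theorem realAeval_monomial (S : X →ₗ[A] X) (n : ℕ) (a : ℝ) (ξ : X) :
    realAeval S (Polynomial.monomial n a) ξ = (a : ℂ) • (S^[n] ξ) := by
  simp [realAeval, Polynomial.aeval_monomial, Module.End.pow_apply, Algebra.algebraMap_eq_smul_one]

theorem realAeval_mul (S : X →ₗ[A] X) (f g : Polynomial ℝ) (ξ : X) :
    realAeval S (f * g) ξ = realAeval S f (realAeval S g ξ) := by
  rw [map_mul]; rfl

theorem realAeval_eq_aeval (S : X →ₗ[A] X) (S₀ : Module.End ℂ X) (h : ∀ ξ, S₀ ξ = S ξ)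
    (q : Polynomial ℝ) (ξ : X) :
    Polynomial.aeval S₀ (q.map (algebraMap ℝ ℂ)) ξ = realAeval S q ξ := by
  have hfun : (S₀ : X → X) = S := funext h
  induction q using Polynomial.induction_on' with
  | add f g hf hg =>
    rw [Polynomial.map_add, map_add, map_add, LinearMap.add_apply, LinearMap.add_apply, hf, hg]
  | monomial n a =>
    rw [realAeval_monomial, Polynomial.map_monomial, Polynomial.aeval_monomial, ← hfun]
    simp [Module.End.pow_apply, Algebra.algebraMap_eq_smul_one]

theorem realAeval_commute (S : X →ₗ[A] X) (L : X → X) (hadd : ∀ ξ η, L (ξ + η) = L ξ + L η)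
    (hsmul : ∀ (c : ℂ) ξ, L (c • ξ) = c • L ξ) (h : ∀ ξ, L (S ξ) = S (L ξ)) (q : Polynomial ℝ)
    (ξ : X) : L (realAeval S q ξ) = realAeval S q (L ξ) := by
  induction q using Polynomial.induction_on' with
  | add f g hf hg => rw [map_add, LinearMap.add_apply, LinearMap.add_apply, hadd, hf, hg]
  | monomial n a =>
    rw [realAeval_monomial, realAeval_monomial, hsmul]
    congr 1
    exact (Function.Commute.iterate_right (f := L) (g := S) h n) ξ

theorem IsModuleSymmetric.realAeval [StarRing A] [PartialOrder A]
    [PreHilbertProCStarModule A X] [StarModule ℂ A] {S : X →ₗ[A] X} (hS : IsModuleSymmetric A S)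
    (q : Polynomial ℝ) : IsModuleSymmetric A (realAeval S q) := by
  induction q using Polynomial.induction_on' with
  | add f g hf hg =>
    intro ξ η
    rw [map_add, LinearMap.add_apply, LinearMap.add_apply, moduleInner_add_left, moduleInner_add_right, hf, hg]
  | monomial n a =>
    intro ξ η
    rw [realAeval_monomial, realAeval_monomial, moduleInner_csmul_left, moduleInner_csmul_right]
    have hn : ∀ (n : ℕ) (ξ η : X), moduleInner A (S^[n] ξ) η = moduleInner A ξ (S^[n] η) := by
      intro n
      induction n with
      | zero => intro ξ η; rfl
      | succ n ih =>
        intro ξ η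
        rw [Function.iterate_succ_apply, ih, hS, ← Function.iterate_succ_apply' S]
    rw [hn]
    simp

end Polynomial

/-! ### Polynomial bounds for a symmetric positive operator in one seminorm. -/

section Estimate

variable {A : Type u} {X : Type*} [Ring A] [StarRing A] [Algebra ℂ A] [PartialOrder A]
  [StarOrderedRing A] [StarModule ℂ A] [TopologicalSpace A]
  [AddCommGroup X] [Module ℂ X] [Module A X] [IsScalarTower ℂ A X] [PreHilbertProCStarModule A X]
  (p : ContCStarSeminorm A)

theorem moduleSeminorm_csmul (c : ℂ) (ξ : X) :
    moduleSeminorm p (c • ξ) = ‖c‖ * moduleSeminorm p ξ :=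
  map_smul_eq_mul (p.onModule X) c ξ

theorem moduleSeminorm_add_le (ξ η : X) :
    moduleSeminorm p (ξ + η) ≤ moduleSeminorm p ξ + moduleSeminorm p η :=
  map_add_le_add (p.onModule X) ξ η

theorem moduleSeminorm_sub_rev (ξ η : X) :
    moduleSeminorm p (ξ - η) = moduleSeminorm p (η - ξ) :=
  map_sub_rev (p.onModule X) ξ η

/-- A symmetric positive operator that is bounded below by `c` and above by `M` has bounded below
shifts by `z ∉ [c, M]`. -/
theorem exists_moduleSeminorm_le_shift {S : X →ₗ[A] X} (hsym : IsModuleSymmetric A S)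
    (hpos : ∀ ξ, 0 ≤ moduleInner A (S ξ) ξ) {c M : ℝ}
    (hc : ∀ ξ, c * moduleSeminorm p ξ ≤ moduleSeminorm p (S ξ))
    (hM : ∀ ξ, moduleSeminorm p (S ξ) ≤ M * moduleSeminorm p ξ) {z : ℂ}
    (hz : ∀ t : ℝ, t ∈ Set.Icc c M → z ≠ t) :
    ∃ m : ℝ, ∀ ξ, moduleSeminorm p ξ ≤ m * moduleSeminorm p (S ξ - z • ξ) := by
  have hscale : ∀ β : ℝ, β ≠ 0 →
      (∀ ξ, moduleSeminorm p ((β : ℂ) • ξ) ≤ moduleSeminorm p (S ξ - z • ξ)) →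
      ∃ m : ℝ, ∀ ξ, moduleSeminorm p ξ ≤ m * moduleSeminorm p (S ξ - z • ξ) := fun β hβ h => by
    refine ⟨|β|⁻¹, fun ξ => ?_⟩
    rw [inv_mul_eq_div, le_div_iff₀ (abs_pos.2 hβ), mul_comm]
    simpa only [moduleSeminorm_csmul, Complex.norm_real, Real.norm_eq_abs] using h ξ
  have hcsmul : ∀ (a : ℂ) (ξ : X), S (a • ξ) = a • S ξ := fun a ξ => by
    rw [← algebraMap_smul A a ξ, map_smul, algebraMap_smul]
  by_cases him : z.im = 0
  · obtain ⟨t, rfl⟩ : ∃ t : ℝ, z = t := ⟨z.re, Complex.ext rfl (by simpa using him)⟩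
    rcases lt_or_ge t 0 with ht0 | ht0
    -- For `t < 0`, `⟨(S - t)ξ, (S - t)ξ⟩ = ⟨Sξ, Sξ⟩ - 2t⟨Sξ, ξ⟩ + t²⟨ξ, ξ⟩ ≥ t²⟨ξ, ξ⟩` by
    -- positivity of `S`.
    · refine hscale t ht0.ne fun ξ => moduleSeminorm_le_of_inner_le p ?_
      have h1 : 0 ≤ (((-(2 * t) : ℝ) : ℂ)) • moduleInner A (S ξ) ξ := by
        have h2 := hpos (((√(-(2 * t)) : ℝ) : ℂ) • ξ)
        rw [hcsmul, moduleInner_csmul_left, moduleInner_csmul_right, smul_smul] at h2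
        convert h2 using 2
        rw [Complex.star_def, Complex.conj_ofReal, ← Complex.ofReal_mul,
          Real.mul_self_sqrt (by linarith)]
      have h2 := moduleInner_self_nonneg (A := A) (S ξ)
      rw [← sub_nonneg]
      convert add_nonneg h1 h2 using 1
      simp only [moduleInner_sub_left, moduleInner_sub_right, moduleInner_csmul_left,
        moduleInner_csmul_right, Complex.star_def, Complex.conj_ofReal, ← hsym ξ ξ]
      push_cast
      module
    · by_cases htc : t < c
      · refine ⟨(c - t)⁻¹, fun ξ => ?_⟩
        rw [inv_mul_eq_div, le_div_iff₀ (sub_pos.2 htc)]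
        have h1 := moduleSeminorm_add_le p (S ξ - (t : ℂ) • ξ) ((t : ℂ) • ξ)
        rw [sub_add_cancel, moduleSeminorm_csmul, Complex.norm_real, Real.norm_of_nonneg ht0] at h1
        linarith [hc ξ]
      · have htM : M < t := by
          by_contra hcon
          exact hz t ⟨not_lt.1 htc, not_lt.1 hcon⟩ rfl
        refine ⟨(t - M)⁻¹, fun ξ => ?_⟩
        rw [inv_mul_eq_div, le_div_iff₀ (sub_pos.2 htM)]
        have h1 := moduleSeminorm_add_le p ((t : ℂ) • ξ - S ξ) (S ξ)
        rw [sub_add_cancel, moduleSeminorm_csmul, Complex.norm_real, Real.norm_of_nonneg ht0,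
          moduleSeminorm_sub_rev] at h1
        linarith [hM ξ]
  -- With `ζ = Sξ - (Re z)ξ`, symmetry cancels the cross terms: `⟨(S - z)ξ, (S - z)ξ⟩ = ⟨ζ, ζ⟩ + (Im
  -- z)²⟨ξ, ξ⟩`.
  · refine hscale z.im him fun ξ => moduleSeminorm_le_of_inner_le p ?_
    set ζ := S ξ - (z.re : ℂ) • ξ with hζ
    have h1 : S ξ - z • ξ = ζ - ((z.im : ℂ) * Complex.I) • ξ := by
      conv_lhs => rw [← Complex.re_add_im z]
      rw [hζ]
      module
    have h2 : moduleInner A ξ ζ = moduleInner A ζ ξ := by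
      rw [hζ, moduleInner_sub_left, moduleInner_sub_right, hsym, moduleInner_csmul_left,
        moduleInner_csmul_right, Complex.star_def, Complex.conj_ofReal]
    rw [← sub_nonneg]
    convert moduleInner_self_nonneg (A := A) ζ using 1
    rw [h1]
    simp only [moduleInner_sub_left, moduleInner_sub_right, moduleInner_csmul_left,
        moduleInner_csmul_right, Complex.star_def, Complex.conj_ofReal, map_mul, Complex.conj_I, h2]
    match_scalars <;> ring_nf
    simp [Complex.I_sq]

/-- The substitute for the C⋆-identity is `⟨q(S)ξ, q(S)ξ⟩ = ⟨q²(S)ξ, ξ⟩`, valid because `q` is real,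
followed by Cauchy–Schwarz. -/
theorem moduleSeminorm_realAeval_le {S : X →ₗ[A] X} (hsym : IsModuleSymmetric A S)
    (hpos : ∀ ξ, 0 ≤ moduleInner A (S ξ) ξ) {c M r : ℝ}
    (hc : ∀ ξ, c * moduleSeminorm p ξ ≤ moduleSeminorm p (S ξ))
    (hM : ∀ ξ, moduleSeminorm p (S ξ) ≤ M * moduleSeminorm p ξ) (hr : 0 ≤ r)
    (q : Polynomial ℝ) (hq : ∀ t ∈ Set.Icc c M, |q.eval t| ≤ r) (ξ : X) :
    moduleSeminorm p (realAeval S q ξ) ≤ r * moduleSeminorm p ξ := by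
  let S₀ : Module.End ℂ X :=
    { toFun := S
      map_add' := map_add S
      map_smul' := fun a ξ => by
        rw [← algebraMap_smul A a ξ, map_smul, algebraMap_smul, RingHom.id_apply] }
  have h := realAeval_eq_aeval S S₀ fun _ => rfl
  rw [← h]
  refine (p.onModule X).aeval_le_of_bounded_below S₀ hM
    (fun z hz => exists_moduleSeminorm_le_shift p hsym hpos hc hM hz) (fun q ξ => ?_) hr q hq ξ
  rw [h, h, sq q, realAeval_mul]
  change moduleSeminorm p _ ^ 2 ≤ moduleSeminorm p _ * moduleSeminorm p ξ
  rw [moduleSeminorm_sq, ← hsym.realAeval q]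
  exact moduleInner_le_moduleSeminorm_mul p _ _

end Estimate

/-! ### Convergence in Hilbert modules and limits of symmetric operators. -/

section Topology

variable {A : Type u} {X : Type*} [Ring A] [StarRing A] [Algebra ℂ A] [PartialOrder A]
  [StarOrderedRing A] [UniformSpace A] [IsProCStarAlgebra A]
  [AddCommGroup X] [Module ℂ X] [Module A X] [IsScalarTower ℂ A X] [PreHilbertProCStarModule A X]
  {ι : Type*} {l : Filter ι}

omit [PartialOrder A] [StarOrderedRing A] in
theorem IsProCStarAlgebra.tendsto_zero {f : ι → A} :
    Tendsto f l (𝓝 0) ↔ ∀ p : ContCStarSeminorm A, Tendsto (fun i => p (f i)) l (𝓝 0) :=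
  IsProCStarAlgebra.tendsto_zero_iff (map f l)

variable [UniformSpace X] [IsHilbertProCStarModule A X]

variable (A) in
omit [StarOrderedRing A] [IsProCStarAlgebra A] in
theorem IsHilbertProCStarModule.tendsto_zero {f : ι → X} :
    Tendsto f l (𝓝 0) ↔
      ∀ p : ContCStarSeminorm A, Tendsto (fun i => moduleSeminorm p (f i)) l (𝓝 0) := by
  rw [IsHilbertProCStarModule.nhds_zero (A := A) (X := X), tendsto_iInf]
  simp only [tendsto_comap_iff]
  rfl

variable (A) in
omit [StarOrderedRing A] [IsProCStarAlgebra A] in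
theorem IsHilbertProCStarModule.tendsto_nhds {f : ι → X} {ξ : X} :
    Tendsto f l (𝓝 ξ) ↔
      ∀ p : ContCStarSeminorm A, Tendsto (fun i => moduleSeminorm p (f i - ξ)) l (𝓝 0) := by
  have := IsHilbertProCStarModule.isUniformAddGroup (A := A) (X := X)
  rw [← IsHilbertProCStarModule.tendsto_zero A (f := fun i => f i - ξ), ← tendsto_sub_nhds_zero_iff]

theorem tendsto_moduleSeminorm (p : ContCStarSeminorm A) {f : ι → X} {ξ : X}
    (h : Tendsto f l (𝓝 ξ)) :
    Tendsto (fun i => moduleSeminorm p (f i)) l (𝓝 (moduleSeminorm p ξ)) := by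
  rw [tendsto_iff_norm_sub_tendsto_zero]
  refine squeeze_zero (fun _ => norm_nonneg _) (fun i => ?_)
    ((IsHilbertProCStarModule.tendsto_nhds A).1 h p)
  exact (p.onModule X).norm_sub_map_le_sub (f i) ξ

theorem tendsto_moduleInner_left {f : ι → X} {ξ : X} (h : Tendsto f l (𝓝 ξ)) (η : X) :
    Tendsto (fun i => moduleInner A (f i) η) l (𝓝 (moduleInner A ξ η)) := by
  rw [← tendsto_sub_nhds_zero_iff, IsProCStarAlgebra.tendsto_zero]
  intro p
  refine squeeze_zero (fun _ => p.nonneg _) (fun i => ?_)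
    (by simpa using ((IsHilbertProCStarModule.tendsto_nhds A).1 h p).mul_const (moduleSeminorm p η))
  rw [← moduleInner_sub_left]
  exact moduleInner_le_moduleSeminorm_mul p _ _

theorem tendsto_moduleInner_right {f : ι → X} {ξ : X} (h : Tendsto f l (𝓝 ξ)) (η : X) :
    Tendsto (fun i => moduleInner A η (f i)) l (𝓝 (moduleInner A η ξ)) := by
  have := (continuous_star.tendsto _).comp (tendsto_moduleInner_left (A := A) h η)
  simpa only [Function.comp_def, star_moduleInner] using this

theorem IsHilbertProCStarModule.t2Space (A : Type u) {X : Type*} [Ring A] [StarRing A]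
    [Algebra ℂ A] [PartialOrder A] [StarOrderedRing A] [UniformSpace A] [IsProCStarAlgebra A]
    [AddCommGroup X] [Module ℂ X] [Module A X] [IsScalarTower ℂ A X] [PreHilbertProCStarModule A X]
    [UniformSpace X] [IsHilbertProCStarModule A X] : T2Space X := by
  rw [t2_iff_nhds]
  intro ξ ζ hne
  rw [← sub_eq_zero, ← moduleInner_self_eq_zero (A := A)]
  have h1 : Tendsto id (𝓝 ξ ⊓ 𝓝 ζ) (𝓝 ξ) := inf_le_left
  have h2 : Tendsto id (𝓝 ξ ⊓ 𝓝 ζ) (𝓝 ζ) := inf_le_right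
  have h3 := tendsto_nhds_unique (tendsto_moduleInner_left (A := A) h1 (ξ - ζ))
    (tendsto_moduleInner_left h2 (ξ - ζ))
  rw [moduleInner_sub_left, h3, sub_self]

omit [StarOrderedRing A] [IsProCStarAlgebra A] in
theorem tendsto_of_moduleSeminorm_bounded {U : X → X} (hsub : ∀ ξ ζ, U (ξ - ζ) = U ξ - U ζ)
    (hb : ∀ p : ContCStarSeminorm A, ∃ M : ℝ, ∀ ξ, moduleSeminorm p (U ξ) ≤ M * moduleSeminorm p ξ)
    {f : ι → X} {ξ : X} (h : Tendsto f l (𝓝 ξ)) : Tendsto (fun i => U (f i)) l (𝓝 (U ξ)) := by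
  rw [IsHilbertProCStarModule.tendsto_nhds A] at h ⊢
  intro p
  obtain ⟨M, hM⟩ := hb p
  refine squeeze_zero (fun _ => moduleSeminorm_nonneg p _) (fun i => ?_)
    (by simpa using (h p).const_mul M)
  rw [← hsub]
  exact hM _

omit [StarOrderedRing A] [IsProCStarAlgebra A] in
theorem AdjointableOperator.tendsto (U : AdjointableOperator A X X) {f : ι → X} {ξ : X}
    (h : Tendsto f l (𝓝 ξ)) : Tendsto (fun i => U (f i)) l (𝓝 (U ξ)) :=
  tendsto_of_moduleSeminorm_bounded (A := A) (map_sub U.toLinearMap)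
    (fun p => (U.bounded p).imp fun _ h => h.2) h

/-- Pointwise limits of symmetric operators that are bounded uniformly for each seminorm. -/
theorem exists_adjointable_of_tendsto [l.NeBot] (L : ι → X →ₗ[A] X)
    (hL : ∀ i, IsModuleSymmetric A (L i)) (T : X → X)
    (hT : ∀ ξ, Tendsto (fun i => L i ξ) l (𝓝 (T ξ)))
    (hb : ∀ p : ContCStarSeminorm A, ∃ M : ℝ, 0 < M ∧
      ∀ ξ, ∀ᶠ i in l, moduleSeminorm p (L i ξ) ≤ M * moduleSeminorm p ξ) :
    ∃ T' : AdjointableOperator A X X, (∀ ξ, T' ξ = T ξ) ∧ IsModuleSymmetric A T' := by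
  have := IsHilbertProCStarModule.isUniformAddGroup (A := A) (X := X)
  have := IsHilbertProCStarModule.t2Space A (X := X)
  have hsym : IsModuleSymmetric A T := fun ξ η =>
    tendsto_nhds_unique (tendsto_moduleInner_left (hT ξ) η) (by
      simpa only [hL _ ξ η] using tendsto_moduleInner_right (hT η) ξ)
  refine ⟨{
    toFun := T
    map_add' := fun ξ η => tendsto_nhds_unique (hT (ξ + η)) (by
      simpa only [map_add] using (hT ξ).add (hT η))
    map_smul' := fun a ξ => tendsto_nhds_unique (hT (a • ξ)) (by
      simpa only [map_smul, RingHom.id_apply] using tendsto_of_moduleSeminorm_bounded (A := A) (U := fun ξ => a • ξ)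
        (smul_sub a) (fun p => ⟨p a, moduleSeminorm_smul_le p a⟩) (hT ξ))
    adj := T
    inner_map_left := hsym
    bounded := fun p => ?_ }, fun _ => rfl, hsym⟩
  obtain ⟨M, hM0, hM⟩ := hb p
  exact ⟨M, hM0, fun ξ => le_of_tendsto (tendsto_moduleSeminorm p (hT ξ)) (hM ξ)⟩

end Topology

/-! ### Inverse fourth and square roots. -/

section FunctionalCalculus

variable {A : Type u} {X : Type*} [Ring A] [StarRing A] [Algebra ℂ A] [PartialOrder A]
  [StarOrderedRing A] [UniformSpace A] [IsProCStarAlgebra A]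
  [AddCommGroup X] [Module ℂ X] [Module A X] [IsScalarTower ℂ A X] [PreHilbertProCStarModule A X]
  [UniformSpace X] [IsHilbertProCStarModule A X]
  {ι : Type*} {l : Filter ι}

/-- A symmetric positive operator is bounded below by a positive constant for each seminorm. -/
structure IsStrictlyPositiveOperator (S : AdjointableOperator A X X) : Prop where
  symm : IsModuleSymmetric A S
  pos : S.IsPositive
  bounded_below : ∀ p : ContCStarSeminorm A, ∃ c : ℝ, 0 < c ∧
    ∀ ξ : X, c * moduleSeminorm p ξ ≤ moduleSeminorm p (S ξ)

namespace IsStrictlyPositiveOperator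

variable {S : AdjointableOperator A X X}

omit [UniformSpace X] [IsHilbertProCStarModule A X] in
/-- For each seminorm, the polynomials in `S` are controlled by their values on some `[c, M]`. -/
theorem exists_interval (hS : IsStrictlyPositiveOperator S) (p : ContCStarSeminorm A) :
    ∃ c M : ℝ, 0 < c ∧ ∀ (q : Polynomial ℝ) (r : ℝ), 0 ≤ r → (∀ t ∈ Set.Icc c M, |q.eval t| ≤ r) →
      ∀ ξ, moduleSeminorm p (realAeval S.toLinearMap q ξ) ≤ r * moduleSeminorm p ξ := by
  obtain ⟨c, hc0, hc⟩ := hS.bounded_below p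
  obtain ⟨M, -, hM⟩ := S.bounded p
  exact ⟨c, M, hc0, fun q r hr hq ξ => moduleSeminorm_realAeval_le p hS.symm hS.pos hc hM hr q hq ξ⟩

/-- Each seminorm comes with its own `[c, M]`, so uniform smallness is required on all of them. -/
theorem tendsto_zero (hS : IsStrictlyPositiveOperator S) {r : ι → Polynomial ℝ}
    (hr : ∀ c M ε : ℝ, 0 < c → 0 < ε → ∀ᶠ i in l, ∀ t ∈ Set.Icc c M, |(r i).eval t| ≤ ε) (ξ : X) :
    Tendsto (fun i => realAeval S.toLinearMap (r i) ξ) l (𝓝 0) := by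
  rw [IsHilbertProCStarModule.tendsto_zero A]
  intro p
  obtain ⟨c, M, hc, h⟩ := hS.exists_interval p
  have h0 := moduleSeminorm_nonneg p ξ
  rw [Metric.tendsto_nhds]
  intro ε hε
  filter_upwards [hr c M (ε / 2 / (moduleSeminorm p ξ + 1)) hc (by positivity)] with i hi
  rw [Real.dist_eq, sub_zero, abs_of_nonneg (moduleSeminorm_nonneg p _)]
  refine (h _ _ (by positivity) hi ξ).trans_lt ?_
  rw [div_mul_eq_mul_div, div_lt_iff₀ (by positivity)]
  nlinarith

/-- Split `f(S) g(S) ξ` as `f(S)(g(S)ξ - Vξ) + f(S)Vξ`; the eventual bounds on `f` send the first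
term to `0`. -/
theorem tendsto_mul (hS : IsStrictlyPositiveOperator S) {f g : ι → Polynomial ℝ} {U V : X → X}
    (hf : ∀ c M : ℝ, 0 < c → ∃ K : ℝ, ∀ᶠ i in l, ∀ t ∈ Set.Icc c M, |(f i).eval t| ≤ K)
    (hU : ∀ ξ, Tendsto (fun i => realAeval S.toLinearMap (f i) ξ) l (𝓝 (U ξ)))
    (hV : ∀ ξ, Tendsto (fun i => realAeval S.toLinearMap (g i) ξ) l (𝓝 (V ξ))) (ξ : X) :
    Tendsto (fun i => realAeval S.toLinearMap (f i * g i) ξ) l (𝓝 (U (V ξ))) := by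
  have := IsHilbertProCStarModule.isUniformAddGroup (A := A) (X := X)
  have h1 : Tendsto (fun i => realAeval S.toLinearMap (f i)
      (realAeval S.toLinearMap (g i) ξ - V ξ)) l (𝓝 0) := by
    rw [IsHilbertProCStarModule.tendsto_zero A]
    intro p
    obtain ⟨c, M, hc, h⟩ := hS.exists_interval p
    obtain ⟨K, hK⟩ := hf c M hc
    refine squeeze_zero' (Eventually.of_forall fun i => moduleSeminorm_nonneg p _)
      (hK.mono fun i hi => h _ |K| (abs_nonneg K) (fun t ht => (hi t ht).trans (le_abs_self K)) _) ?_
    simpa using ((IsHilbertProCStarModule.tendsto_nhds A).1 (hV ξ) p).const_mul |K|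
  have h2 := h1.add (hU (V ξ))
  rw [zero_add] at h2
  refine h2.congr fun i => ?_
  rw [realAeval_mul, map_sub, sub_add_cancel]

/-- The inverse fourth root of a strictly positive operator. -/
theorem exists_inv_fourth_root (hS : IsStrictlyPositiveOperator S) :
    ∃ R : AdjointableOperator A X X, IsModuleSymmetric A R ∧ (∀ ξ, R (R (R (R (S ξ)))) = ξ) ∧
      ∀ L : AdjointableOperator A X X, (∀ ξ, L (S ξ) = S (L ξ)) → ∀ ξ, L (R ξ) = R (L ξ) := by
  have := IsHilbertProCStarModule.isUniformAddGroup (A := A) (X := X)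
  have := IsHilbertProCStarModule.completeSpace (A := A) (X := X)
  have := IsHilbertProCStarModule.t2Space A (X := X)
  set φ : ℝ → ℝ := fun t => √(√t⁻¹) with hφ
  have hφc : ∀ c M : ℝ, 0 < c → ContinuousOn φ (Set.Icc c M) := fun c M hc =>
    Real.continuous_sqrt.comp_continuousOn (Real.continuous_sqrt.comp_continuousOn
      (continuousOn_inv₀.mono fun t ht => (hc.trans_le ht.1).ne'))
  have hφ4 : ∀ t : ℝ, 0 < t → φ t ^ 4 * t = 1 := fun t ht => by
    have : φ t ^ 4 = (φ t ^ 2) ^ 2 := by ring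
    rw [this, hφ, Real.sq_sqrt (Real.sqrt_nonneg _), Real.sq_sqrt (inv_nonneg.2 ht.le),
      inv_mul_cancel₀ ht.ne']
  -- Weierstrass approximation on intervals exhausting `(0, ∞)`, with error tending to `0`: one
  -- sequence then serves every seminorm.
  have hex : ∀ n : ℕ, ∃ q : Polynomial ℝ, ∀ t ∈ Set.Icc (1 / ((n : ℝ) + 1)) ((n : ℝ) + 1),
      |q.eval t - φ t| < 1 / ((n : ℝ) + 1) := fun n =>
    exists_polynomial_near_of_continuousOn _ _ φ (hφc _ _ (by positivity)) _ (by positivity)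
  choose q hq using hex
  have hev : ∀ c M ε : ℝ, 0 < c → 0 < ε →
      ∀ᶠ n in atTop, ∀ t ∈ Set.Icc c M, |(q n).eval t - φ t| ≤ ε := fun c M ε hc hε => by
    have h1 := tendsto_one_div_add_atTop_nhds_zero_nat (𝕜 := ℝ)
    have h2 : Tendsto (fun n : ℕ => (n : ℝ) + 1) atTop atTop :=
      tendsto_atTop_add_const_right _ _ tendsto_natCast_atTop_atTop
    filter_upwards [h1.eventually_le_const hc, h1.eventually_le_const hε, h2.eventually_ge_atTop M]
      with n hn1 hn2 hn3 t ht
    exact (hq n t ⟨hn1.trans ht.1, ht.2.trans hn3⟩).le.trans hn2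
  have hbd : ∀ c M : ℝ, 0 < c → ∃ K : ℝ, 0 < K ∧
      ∀ᶠ n in atTop, ∀ t ∈ Set.Icc c M, |(q n).eval t| ≤ K := fun c M hc => by
    obtain ⟨K, hK⟩ := isCompact_Icc.exists_bound_of_continuousOn (hφc c M hc)
    refine ⟨|K| + 1, by positivity, (hev c M 1 hc one_pos).mono fun n hn t ht => ?_⟩
    have h1 := hK t ht
    rw [Real.norm_eq_abs] at h1
    have h2 := abs_add_le ((q n).eval t - φ t) (φ t)
    rw [sub_add_cancel] at h2
    linarith [hn t ht, le_abs_self K]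
  have hcauchy : ∀ ξ, CauchySeq fun n => realAeval S.toLinearMap (q n) ξ := fun ξ => by
    rw [cauchySeq_iff_tendsto, uniformity_eq_comap_nhds_zero, tendsto_comap_iff,
      ← prod_atTop_atTop_eq]
    have h1 := hS.tendsto_zero (l := (atTop : Filter ℕ) ×ˢ (atTop : Filter ℕ))
      (r := fun n => q n.2 - q n.1) (fun c M ε hc hε => by
        have h2 := hev c M (ε / 2) hc (half_pos hε)
        filter_upwards [h2.prod_mk h2] with n hn t ht
        have h3 := hn.1 t ht
        have h4 := hn.2 t ht
        rw [abs_le] at h3 h4 ⊢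
        rw [Polynomial.eval_sub]
        constructor <;> linarith [h3.1, h3.2, h4.1, h4.2]) ξ
    refine h1.congr fun n => ?_
    rw [map_sub, LinearMap.sub_apply]
    rfl
  choose R₀ hR₀ using fun ξ => cauchySeq_tendsto_of_complete (hcauchy ξ)
  obtain ⟨R, hRR, hRsym⟩ := exists_adjointable_of_tendsto
    (fun n => realAeval S.toLinearMap (q n)) (fun n => hS.symm.realAeval (q n)) R₀ hR₀ (fun p => by
      obtain ⟨c, M, hc, h⟩ := hS.exists_interval p
      obtain ⟨K, hK0, hK⟩ := hbd c M hc
      exact ⟨K, hK0, fun ξ => hK.mono fun n hn => h _ K hK0.le hn ξ⟩)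
  have hR : ∀ ξ, Tendsto (fun n => realAeval S.toLinearMap (q n) ξ) atTop (𝓝 (R ξ)) :=
    fun ξ => by rw [hRR]; exact hR₀ ξ
  refine ⟨R, hRsym, fun ξ => ?_, fun L hL ξ => ?_⟩
  · have hq1 : ∀ c M : ℝ, 0 < c → ∃ K : ℝ, ∀ᶠ n in atTop, ∀ t ∈ Set.Icc c M, |(q n).eval t| ≤ K :=
      fun c M hc => (hbd c M hc).imp fun K h => h.2
    have h2 := hS.tendsto_mul hq1 hR hR
    have h3 := hS.tendsto_mul hq1 hR h2
    have h4 := hS.tendsto_mul hq1 hR h3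
    refine tendsto_nhds_unique (h4 (S ξ)) ?_
    have h5 := hS.tendsto_zero (l := atTop)
      (r := fun n => q n * (q n * (q n * q n)) * Polynomial.X - 1) (fun c M ε hc hε => by
        obtain ⟨K, hK0, hK⟩ := hbd c M hc
        obtain ⟨K', hK'⟩ := isCompact_Icc.exists_bound_of_continuousOn (hφc c M hc)
        -- As `φ⁴ t = 1`, `q⁴ t - 1 = (q - φ)(q + φ)(q² + φ²)t`; `C` bounds the factors after the
        -- first, and `+ 1` keeps it positive.
        set C := (K + |K'|) * (K ^ 2 + K' ^ 2) * |M| + 1 with hC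
        have hC0 : 0 < C := by positivity
        filter_upwards [hK, hev c M (ε / C) hc (by positivity)] with n hn1 hn2 t ht
        have ht0 : 0 < t := hc.trans_le ht.1
        have e1 : (q n * (q n * (q n * q n)) * Polynomial.X - 1).eval t
            = ((q n).eval t - φ t) * (((q n).eval t + φ t) * ((q n).eval t ^ 2 + φ t ^ 2) * t) := by
          simp only [Polynomial.eval_sub, Polynomial.eval_mul, Polynomial.eval_X, Polynomial.eval_one]
          linear_combination hφ4 t ht0
        have b1 := hn1 t ht
        have b2 : |φ t| ≤ |K'| := (hK' t ht).trans (le_abs_self _)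
        have b3 : |((q n).eval t + φ t) * ((q n).eval t ^ 2 + φ t ^ 2) * t| ≤ C := by
          rw [abs_mul, abs_mul]
          have c1 : |(q n).eval t + φ t| ≤ K + |K'| := (abs_add_le _ _).trans (add_le_add b1 b2)
          have c2 : |(q n).eval t ^ 2 + φ t ^ 2| ≤ K ^ 2 + K' ^ 2 := by
            rw [abs_of_nonneg (by positivity)]
            exact add_le_add (sq_le_sq.2 (b1.trans (le_abs_self K))) (sq_le_sq.2 b2)
          have c3 : |t| ≤ |M| := abs_le_abs_of_nonneg ht0.le ht.2
          calc _ ≤ (K + |K'|) * (K ^ 2 + K' ^ 2) * |M| := by gcongr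
            _ ≤ C := by rw [hC]; linarith
        rw [e1, abs_mul]
        calc _ ≤ ε / C * C := by gcongr; exact hn2 t ht
          _ = ε := div_mul_cancel₀ _ hC0.ne') ξ
    have h6 := h5.add_const ξ
    rw [zero_add] at h6
    refine h6.congr fun n => ?_
    rw [map_sub, map_one, LinearMap.sub_apply, realAeval_mul, realAeval_X]
    exact sub_add_cancel _ _
  · refine tendsto_nhds_unique (L.tendsto (hR ξ)) ?_
    have hLc : ∀ (c : ℂ) (ξ : X), L (c • ξ) = c • L ξ := fun c ξ => by
      rw [← algebraMap_smul A c ξ, map_smul, algebraMap_smul]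
    simpa only [realAeval_commute S.toLinearMap L (map_add L.toLinearMap) hLc hL] using hR (L ξ)

/-- The inverse square root of a strictly positive operator. -/
theorem existsUnique_isInvSqrt (hS : IsStrictlyPositiveOperator S) :
    ∃ Q : AdjointableOperator A X X, S.IsInvSqrt Q ∧ IsModuleSymmetric A Q ∧
      (∀ ξ, Q (S (Q ξ)) = ξ) ∧ ∀ Q', S.IsInvSqrt Q' → Q' = Q := by
  obtain ⟨R, hRsym, hR4, hcomm⟩ := hS.exists_inv_fourth_root
  have hRS : ∀ ξ, R (S ξ) = S (R ξ) := fun ξ => (hcomm S (fun _ => rfl) ξ).symm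
  have hinv : ∀ ξ, S (R (R (R (R ξ)))) = ξ := fun ξ => by
    rw [← hRS, ← hRS, ← hRS, ← hRS, hR4]
  have hRinj : ∀ ξ, R ξ = 0 → ξ = 0 := fun ξ h => by
    rw [← hinv ξ, h]
    simp only [map_zero]
  have hQsym : IsModuleSymmetric A (R.comp R) := fun ξ η =>
    (hRsym (R ξ) η).trans (hRsym ξ (R η))
  refine ⟨R.comp R, ⟨(R.comp R).comp (R.comp R), hinv, hR4, fun ξ => ?_, fun _ => rfl⟩, hQsym,
    fun ξ => ?_, ?_⟩
  · change 0 ≤ moduleInner A (R (R ξ)) ξ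
    rw [hRsym]
    exact moduleInner_self_nonneg _
  · change R (R (S (R (R ξ)))) = ξ
    rw [hRS, hRS, hinv]
  · rintro Q' ⟨S', hSS', hS'S, hpos, hsq⟩
    have hS' : ∀ ξ, S' ξ = R (R (R (R ξ))) := fun ξ => by
      rw [← hR4 (S' ξ), hSS']
    -- `Q'` commutes with its square `S⁻¹`, hence with `S`, hence with the limit `R` of polynomials
    -- in `S`.
    have hQS : ∀ ξ, Q' (S ξ) = S (Q' ξ) := fun ξ => by
      have h1 : Q' ξ = S' (Q' (S ξ)) := by
        rw [← hsq, hsq (S ξ), hS'S]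
      rw [h1, hSS']
    have hQR := hcomm Q' hQS
    refine AdjointableOperator.ext fun ξ => ?_
    change Q' ξ = R (R ξ)
    rw [← sub_eq_zero]
    -- By commutation `(Q' + R²)η = (Q'² - R⁴)ξ = 0`. Pairing with `η` gives two nonnegative terms
    -- with sum `0`, so `⟨Rη, Rη⟩ = 0`, and `R` is injective.
    set η := Q' ξ - R (R ξ) with hη
    have h1 : Q' η + R (R η) = 0 := by
      rw [hη]
      simp only [map_sub, hsq, hS', hQR]
      abel
    have h2 : moduleInner A (Q' η) η + moduleInner A (R η) (R η) = 0 := by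
      rw [← hRsym (R η), ← moduleInner_add_left, h1, moduleInner_zero_left]
    have h3 : moduleInner A (R η) (R η) = 0 :=
      ((add_eq_zero_iff_of_nonneg (hpos η) (moduleInner_self_nonneg _)).1 h2).2
    exact hRinj η (moduleInner_self_eq_zero.1 h3)

end IsStrictlyPositiveOperator

end FunctionalCalculus

/-! ### The Cauchy criterion for sums as convergence to zero. -/

section VanishingFilter

/-- Along this filter finite sets escape every finite set. -/
def Finset.escaping (I : Type*) : Filter (Finset I) := ⨅ s : Finset I, 𝓟 {t | Disjoint t s}

theorem Finset.hasBasis_escaping (I : Type*) :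
    (Finset.escaping I).HasBasis (fun _ => True) fun s : Finset I => {t | Disjoint t s} := by
  classical
  refine hasBasis_iInf_principal ?_
  intro s t
  refine ⟨s ∪ t, fun x hx => ?_, fun x hx => ?_⟩
  · exact Finset.disjoint_of_subset_right Finset.subset_union_left hx
  · exact Finset.disjoint_of_subset_right Finset.subset_union_right hx

/-- In this form summability can be tested seminorm by seminorm and transferred from `A` to `X` by
squeezing. -/
theorem summable_iff_tendsto_escaping {E I : Type*} [AddCommGroup E] [UniformSpace E]
    [IsUniformAddGroup E] [CompleteSpace E] {f : I → E} :
    Summable f ↔ Tendsto (fun t => ∑ i ∈ t, f i) (Finset.escaping I) (𝓝 0) := by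
  rw [summable_iff_vanishing, (Finset.hasBasis_escaping I).tendsto_left_iff]
  simp only [true_and]
  rfl

end VanishingFilter

/-! ### The frame operator and the Parseval frame. -/

section Frames

variable {A : Type u} {X I : Type*} [Ring A] [StarRing A] [Algebra ℂ A] [PartialOrder A]
  [AddCommGroup X] [Module ℂ X] [Module A X] [IsScalarTower ℂ A X] [PreHilbertProCStarModule A X]

namespace AdjointableOperator

variable [TopologicalSpace A]

theorem inner_adj_left (T : AdjointableOperator A X X) (ξ η : X) :
    moduleInner A (T.adj ξ) η = moduleInner A ξ (T η) := by
  rw [← star_moduleInner, ← T.inner_map_left, star_moduleInner]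
  rfl

/-- The adjoint of an adjointable operator, as an `A`-linear map. -/
def adjLinear (T : AdjointableOperator A X X) : X →ₗ[A] X where
  toFun := T.adj
  map_add' := fun ξ η => ext_moduleInner_left (A := A) fun ζ => by
    simp only [moduleInner_add_left, inner_adj_left]
  map_smul' := fun a ξ => ext_moduleInner_left (A := A) fun ζ => by
    simp only [moduleInner_smul_left, inner_adj_left, RingHom.id_apply]

/-- The partial sums `∑ T_i⋆ T_i` of the frame operator. -/
noncomputable def partialSum (T : I → AdjointableOperator A X X) (F : Finset I) : X →ₗ[A] X :=
  ∑ i ∈ F, (T i).adjLinear ∘ₗ (T i).toLinearMap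

variable {T : I → AdjointableOperator A X X}

theorem partialSum_apply (F : Finset I) (ξ : X) :
    partialSum T F ξ = ∑ i ∈ F, (T i).adj (T i ξ) := by
  rw [partialSum, LinearMap.sum_apply]
  rfl

theorem moduleInner_partialSum (F : Finset I) (ξ η : X) :
    moduleInner A (partialSum T F ξ) η = ∑ i ∈ F, moduleInner A (T i ξ) (T i η) := by
  rw [partialSum_apply, moduleInner_sum_left]
  exact Finset.sum_congr rfl fun i _ => (T i).inner_adj_left _ _

theorem isModuleSymmetric_partialSum (F : Finset I) :
    IsModuleSymmetric A (partialSum T F) := fun ξ η => by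
  rw [moduleInner_partialSum, ← star_moduleInner, moduleInner_partialSum, star_sum]
  simp only [star_moduleInner]

end AdjointableOperator

variable [StarOrderedRing A] [UniformSpace A] [IsProCStarAlgebra A]

namespace IsStarOperatorFrameWith

open AdjointableOperator

variable {T : I → AdjointableOperator A X X} {a b : A}

theorem sum_le (hT : IsStarOperatorFrameWith T a b) (p : ContCStarSeminorm A) (F : Finset I)
    (ξ : X) : p (∑ i ∈ F, moduleInner A (T i ξ) (T i ξ)) ≤ (p b * moduleSeminorm p ξ) ^ 2 := by
  have hnn : ∀ G : Finset I, 0 ≤ ∑ i ∈ G, moduleInner A (T i ξ) (T i ξ) :=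
    fun G => Finset.sum_nonneg fun i _ => moduleInner_self_nonneg _
  have h1 : p (∑ i ∈ F, moduleInner A (T i ξ) (T i ξ)) ≤
      p (∑' i, moduleInner A (T i ξ) (T i ξ)) := by
    refine ge_of_tendsto ((p.continuous'.tendsto _).comp (hT.summable ξ).hasSum) ?_
    filter_upwards [eventually_ge_atTop F] with G hG
    exact p.mono (hnn F) (Finset.sum_le_sum_of_subset_of_nonneg hG
      fun i _ _ => moduleInner_self_nonneg _)
  -- The lower frame inequality gives this sign without appeal to closedness of the positive cone.
  have h2 : 0 ≤ ∑' i, moduleInner A (T i ξ) (T i ξ) :=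
    (star_right_conjugate_nonneg (moduleInner_self_nonneg ξ) a).trans (hT.lower ξ)
  refine h1.trans ((p.mono h2 (hT.upper ξ)).trans ?_)
  have h3 := p.mul_le' (b * moduleInner A ξ ξ) (star b)
  have h4 := p.mul_le' b (moduleInner A ξ ξ)
  rw [p.star_eq] at h3
  rw [mul_pow, moduleSeminorm_sq]
  nlinarith [p.nonneg b]

/-- Cauchy–Schwarz for `∑ i ∈ F, ⟨T_i ξ, T_i η⟩`, which equals `⟨η, η⟩` when `η` is the partial sum
at `ξ`; then one factor of the seminorm of `η` squared cancels. The estimate gives both convergence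
and boundedness of the frame operator. -/
theorem moduleSeminorm_partialSum_le (hT : IsStarOperatorFrameWith T a b)
    (p : ContCStarSeminorm A) (F : Finset I) (ξ : X) :
    moduleSeminorm p (partialSum T F ξ) ≤
      p b * √(p (∑ i ∈ F, moduleInner A (T i ξ) (T i ξ))) := by
  set η := partialSum T F ξ with hη
  set u := p (∑ i ∈ F, moduleInner A (T i ξ) (T i ξ)) with hu
  have hu0 : 0 ≤ u := p.nonneg _
  have h1 : p (moduleInner A η η) ^ 2 ≤ u * p (∑ i ∈ F, moduleInner A (T i η) (T i η)) := by
    have := p.cauchy_schwarz (fun ξ η => ∑ i ∈ F, moduleInner A (T i ξ) (T i η))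
      (fun ξ ζ η => by simp only [map_add, moduleInner_add_left, Finset.sum_add_distrib])
      (fun a ξ η => by simp only [map_smul, moduleInner_smul_left, Finset.mul_sum])
      (fun ξ η => by simp only [star_sum, star_moduleInner])
      (fun ξ => Finset.sum_nonneg fun i _ => moduleInner_self_nonneg _) ξ η
    rwa [← moduleInner_partialSum, ← hη] at this
  rw [← moduleSeminorm_sq] at h1
  have h2 := hT.sum_le p F η
  have h3 : (moduleSeminorm p η ^ 2) ^ 2 ≤ ((p b * √u) * moduleSeminorm p η) ^ 2 := by
    calc _ ≤ u * (p b * moduleSeminorm p η) ^ 2 := h1.trans (by gcongr)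
      _ = √u ^ 2 * (p b * moduleSeminorm p η) ^ 2 := by rw [Real.sq_sqrt hu0]
      _ = _ := by ring
  have hη0 := moduleSeminorm_nonneg p η
  have hb0 := p.nonneg b
  have h4 := le_of_sq_le_sq h3 (by positivity)
  rcases hη0.eq_or_lt with h | h
  · rw [← h]
    positivity
  · rw [sq] at h4
    exact le_of_mul_le_mul_right h4 h

variable [UniformSpace X] [IsHilbertProCStarModule A X]

theorem summable_frameOperator (hT : IsStarOperatorFrameWith T a b) (ξ : X) :
    Summable fun i => (T i).adj (T i ξ) := by
  have := IsHilbertProCStarModule.isUniformAddGroup (A := A) (X := X)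
  have := IsHilbertProCStarModule.completeSpace (A := A) (X := X)
  rw [summable_iff_tendsto_escaping, IsHilbertProCStarModule.tendsto_zero A]
  intro p
  have h1 := IsProCStarAlgebra.tendsto_zero.1
    (summable_iff_tendsto_escaping.1 (hT.summable ξ)) p
  refine squeeze_zero (fun _ => moduleSeminorm_nonneg p _) (fun F => ?_)
    (by simpa using ((Real.continuous_sqrt.tendsto _).comp h1).const_mul (p b))
  rw [← partialSum_apply]
  exact hT.moduleSeminorm_partialSum_le p F ξ

theorem exists_isStarFrameOperator (hT : IsStarOperatorFrameWith T a b) :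
    ∃ S : AdjointableOperator A X X, IsStarFrameOperator T S ∧ IsModuleSymmetric A S := by
  obtain ⟨S, hS, hsym⟩ := exists_adjointable_of_tendsto (l := (atTop : Filter (Finset I)))
    (partialSum T) isModuleSymmetric_partialSum (fun ξ => ∑' i, (T i).adj (T i ξ))
    (fun ξ => by
      simp only [partialSum_apply]
      exact (hT.summable_frameOperator ξ).hasSum)
    (fun p => by
      refine ⟨p b * p b + 1, by nlinarith [p.nonneg b], fun ξ => Eventually.of_forall fun F => ?_⟩
      have h0 := moduleSeminorm_nonneg p ξ
      have hb0 := p.nonneg b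
      have h1 := hT.moduleSeminorm_partialSum_le p F ξ
      have h2 : √(p (∑ i ∈ F, moduleInner A (T i ξ) (T i ξ))) ≤ p b * moduleSeminorm p ξ :=
        (Real.sqrt_le_left (by positivity)).2 (hT.sum_le p F ξ)
      nlinarith [mul_le_mul_of_nonneg_left h2 hb0])
  refine ⟨S, fun ξ => ?_, hsym⟩
  rw [hS]
  exact (hT.summable_frameOperator ξ).hasSum

end IsStarOperatorFrameWith

variable [UniformSpace X] [IsHilbertProCStarModule A X]
  {T : I → AdjointableOperator A X X} {S : AdjointableOperator A X X}

theorem IsStarFrameOperator.unique {S' : AdjointableOperator A X X} (hS : IsStarFrameOperator T S)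
    (hS' : IsStarFrameOperator T S') : S = S' :=
  have := IsHilbertProCStarModule.t2Space A (X := X)
  AdjointableOperator.ext fun ξ => (hS ξ).unique (hS' ξ)

theorem IsStarFrameOperator.hasSum_inner (hS : IsStarFrameOperator T S) (ξ : X) :
    HasSum (fun i => moduleInner A (T i ξ) (T i ξ)) (moduleInner A (S ξ) ξ) := by
  refine (tendsto_moduleInner_left (A := A) (hS ξ) ξ).congr fun F => ?_
  rw [moduleInner_sum_left]
  exact Finset.sum_congr rfl fun i _ => (T i).inner_adj_left _ _

/-- Conjugating the lower frame inequality by `v = a⁻¹` gives `⟨ξ, ξ⟩ ≤ v⟨Sξ, ξ⟩v⋆`; Cauchy–Schwarz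
then bounds the seminorm of `ξ` by `p(v)²` times that of `Sξ`. -/
theorem IsStarOperatorFrameWith.isStrictlyPositiveOperator {a b : A}
    (hT : IsStarOperatorFrameWith T a b) (hS : IsStarFrameOperator T S) :
    IsStrictlyPositiveOperator S where
  symm := by
    obtain ⟨S', hS', hsym⟩ := hT.exists_isStarFrameOperator
    rwa [hS.unique hS']
  pos := fun ξ => by
    rw [← (hS.hasSum_inner ξ).tsum_eq]
    exact (star_right_conjugate_nonneg (moduleInner_self_nonneg ξ) a).trans (hT.lower ξ)
  bounded_below := fun p => by
    obtain ⟨u, rfl⟩ := (spectrum.zero_notMem_iff ℂ).1 hT.lower_strictly_nonzero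
    set v : A := ↑u⁻¹ with hv
    -- The `+ 1` covers `p v = 0`.
    refine ⟨(p v ^ 2 + 1)⁻¹, by positivity, fun ξ => ?_⟩
    rw [inv_mul_eq_div, div_le_iff₀ (by positivity)]
    have h1 := star_right_conjugate_le_conjugate (hT.lower ξ) v
    rw [(hS.hasSum_inner ξ).tsum_eq] at h1
    have h2 : v * (u * moduleInner A ξ ξ * star (u : A)) * star v = moduleInner A ξ ξ := by
      have h3 : v * u = 1 := u.inv_mul
      have h4 : star (u : A) * star v = 1 := by rw [← star_mul, h3, star_one]
      rw [mul_assoc, mul_assoc, mul_assoc, h4, mul_one, ← mul_assoc, h3, one_mul]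
    rw [h2] at h1
    have h5 := p.mono (moduleInner_self_nonneg ξ) h1
    have h6 := p.mul_le' (v * moduleInner A (S ξ) ξ) (star v)
    have h7 := p.mul_le' v (moduleInner A (S ξ) ξ)
    have h8 := moduleInner_le_moduleSeminorm_mul p (S ξ) ξ
    rw [p.star_eq] at h6
    rw [← moduleSeminorm_sq] at h5
    have hv0 := p.nonneg v
    have hS0 := moduleSeminorm_nonneg p (S ξ)
    have h9 : moduleSeminorm p ξ * moduleSeminorm p ξ ≤
        (p v ^ 2 * moduleSeminorm p (S ξ)) * moduleSeminorm p ξ :=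
      calc _ ≤ p v * p (moduleInner A (S ξ) ξ) * p v := by
            rw [← sq]
            exact h5.trans (h6.trans (mul_le_mul_of_nonneg_right h7 hv0))
        _ ≤ p v * (moduleSeminorm p (S ξ) * moduleSeminorm p ξ) * p v := by gcongr
        _ = _ := by ring
    rcases (moduleSeminorm_nonneg p ξ).eq_or_lt with h | h
    · rw [← h]
      positivity
    · have := le_of_mul_le_mul_right h9 h
      nlinarith

/-- The sum at `ξ` is `⟨SQξ, Qξ⟩ = ⟨QSQξ, ξ⟩ = ⟨ξ, ξ⟩`. -/
theorem IsStarFrameOperator.isParseval (hS : IsStarFrameOperator T S)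
    {Q : AdjointableOperator A X X} (hQ : IsModuleSymmetric A Q) (hQSQ : ∀ ξ, Q (S (Q ξ)) = ξ) :
    IsParsevalStarOperatorFrame fun i => (T i).comp Q := by
  have hsum : ∀ ξ : X, HasSum (fun i => moduleInner A ((T i).comp Q ξ) ((T i).comp Q ξ))
      (moduleInner A ξ ξ) := fun ξ => by
    have h := hS.hasSum_inner (Q ξ)
    rwa [← hQ, hQSQ] at h
  have h1 : (0 : ℂ) ∉ spectrum ℂ (1 : A) := (spectrum.zero_notMem_iff ℂ).2 isUnit_one
  refine ⟨h1, h1, fun ξ => (hsum ξ).summable, fun ξ => ?_, fun ξ => ?_⟩ <;>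
  rw [(hsum ξ).tsum_eq, star_one, one_mul, mul_one]

end Frames

theorem corollary3p11 {A X I : Type*}
    [Ring A] [StarRing A] [Algebra ℂ A] [PartialOrder A] [StarOrderedRing A]
    [UniformSpace A] [IsProCStarAlgebra A]
    [AddCommGroup X] [Module ℂ X] [Module A X] [IsScalarTower ℂ A X]
    [PreHilbertProCStarModule A X] [UniformSpace X] [IsHilbertProCStarModule A X]
    [Countable I] (T : I → AdjointableOperator A X X) (hT : IsStarOperatorFrame T) :
    (∃! S : AdjointableOperator A X X, IsStarFrameOperator T S) ∧
    ∀ S : AdjointableOperator A X X, IsStarFrameOperator T S →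
      (∃! Q : AdjointableOperator A X X, S.IsInvSqrt Q) ∧
      ∀ Q : AdjointableOperator A X X, S.IsInvSqrt Q →
        IsParsevalStarOperatorFrame (fun i => (T i).comp Q) := by
  obtain ⟨a, b, hT⟩ := hT
  obtain ⟨S₀, hS₀, -⟩ := hT.exists_isStarFrameOperator
  refine ⟨⟨S₀, hS₀, fun S hS => hS.unique hS₀⟩, fun S hS => ?_⟩
  obtain ⟨Q, hQ, hQsym, hQSQ, hQuniq⟩ := (hT.isStrictlyPositiveOperator hS).existsUnique_isInvSqrt
  refine ⟨⟨Q, hQ, hQuniq⟩, fun Q' hQ' => ?_⟩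
  rw [hQuniq Q' hQ']
  exact hS.isParseval hQsym hQSQ
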